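/- Two players, Breaker and Maker, alternately claim previously unclaimed edges of a finite graph $G=(V,E)$, one edge per move, with Breaker moving first. In the perfect matching game on $E$, the winning sets are the edge sets of all matchings of $G$ of size $\lfloor |V|/2\rfloor$. Maker \emph{wins within $m$ moves} if she has a strategy which guarantees, against every strategy of Breaker, that she has claimed all edges of some winning set after at most $m$ of her own moves. (a) For all non-negative integers $k_1,k_2$ there exists an integer $f(k_1,k_2)$ such that the following holds for every $n\ge f(k_1,k_2)$. Let $G=(U_1\cup U_2,E)$ be a bipartite graph with parts $U_1,U_2$ such that (i) $|U_1|=|U_2|=n$; (ii) every $u_1\in U_1$ has at least $n-k_1$ neighbours in $U_2$; (iii) every $u_2\in U_2$ has at least $n-k_2$ neighbours in $U_1$. Then Maker has a strategy to win the perfect matching game, played on $E$, within $n+2$ moves. (b) The bound $n+2$ is best possible, even for $k_1=k_2=1$: for every $n\ge 1$, if $G$ is the graph obtained from the complete bipartite graph $K_{n,n}$ by removing a perfect matching, then Maker has no strategy to win the perfect matching game, played on $E(G)$, within $n+1$ moves. -/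

import Mathlib

/-- A position of a Maker-Breaker game: the elements claimed so far by each of the two players,
most recent first.  Since the players move alternately, this is the complete history of the game. -/
structure MBPosition (α : Type*) where
  breaker : List α
  maker : List α

namespace MBPosition

/-- The initial position: nothing has been claimed. -/
def start (α : Type*) : MBPosition α := ⟨[], []⟩

/-- The element `x` of the board `X` is unclaimed in the position `p`. -/
def Free {α : Type*} (X : Set α) (p : MBPosition α) (x : α) : Prop :=
  x ∈ X ∧ x ∉ p.breaker ∧ x ∉ p.maker

end MBPosition

/-- `s` is a strategy (for either player) on the board `X`: in every position it prescribes an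
unclaimed element of the board, and it prescribes nothing only if the whole board is claimed. -/
def IsMBStrategy {α : Type*} (X : Set α) (s : MBPosition α → Option α) : Prop :=
  ∀ p : MBPosition α,
    (∀ x, s p = some x → p.Free X x) ∧ (s p = none → ∀ x, ¬ p.Free X x)

/-- The position after `m` rounds when Breaker plays according to `τ` and Maker according to `σ`.
In each round Breaker claims one element first, and then Maker claims one element. -/
def mbPlay {α : Type*} (τ σ : MBPosition α → Option α) : ℕ → MBPosition α
  | 0 => MBPosition.start α
  | m + 1 =>
    let p := mbPlay τ σ m
    let q : MBPosition α := ⟨(τ p).toList ++ p.breaker, p.maker⟩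
    ⟨q.breaker, (σ q).toList ++ q.maker⟩

/-- Maker has a strategy to win the (unbiased) Maker-Breaker game with board `X` and family of
winning sets `F` within `m` moves: against every strategy of Breaker, after at most `m` moves
Maker has claimed all the elements of some winning set. -/
def MakerWinsWithin {α : Type*} (X : Set α) (F : Set (Set α)) (m : ℕ) : Prop :=
  ∃ σ : MBPosition α → Option α, IsMBStrategy X σ ∧
    ∀ τ : MBPosition α → Option α, IsMBStrategy X τ →
      ∃ j ≤ m, ∃ W ∈ F, ∀ e ∈ W, e ∈ (mbPlay τ σ j).maker

/-- The winning sets of the perfect matching game on `G`: the edge sets of the matchings of `G`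
with exactly `⌊|V| / 2⌋` edges. -/
def perfectMatchingSets {V : Type*} (G : SimpleGraph V) : Set (Set (Sym2 V)) :=
  {W | ∃ M : G.Subgraph, M.IsMatching ∧ M.edgeSet.ncard = Nat.card V / 2 ∧ W = M.edgeSet}

/-- Maker has a strategy to win the perfect matching game, played on the edge set of `G`,
within `m` moves. -/
def MakerWinsPerfectMatchingWithin {V : Type*} (G : SimpleGraph V) (m : ℕ) : Prop :=
  MakerWinsWithin G.edgeSet (perfectMatchingSets G) m

/-!
Only the pairs of one vertex from each part matter, so the game is played on `α × β`, where `α` and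
`β` are the two parts. A position is given by the set `N` of pairs that are blocked for Maker
(missing edges and edges claimed by Breaker) and the set of Maker's pairs; `MakerWins` and
`BreakerHolds` are the recursively defined values of such a position, and
`makerWinsWithin_of_makerWins` and `not_makerWinsWithin_of_breakerHolds` turn them into strategies.

**Breaker holds for `n + 1` moves.** As long as Maker's edges form a matching, Breaker keeps the
vertices untouched by Maker perfectly matched by blocked pairs: the removed perfect matching does
this at the start, and when Maker claims `(w, z)`, Breaker blocks the pair of the former partners of
`z` and `w` (`breakerHolds_of_matching`). So Maker has to spend her only spare move, which
creates a path of two edges with leaves `a` and `b` and leaves one more untouched vertex on the side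
of its centre. To win she then needs one untouched vertex `x` for which both `(a, x)` and `(b, x)`
are open, and Breaker prevents this by keeping two untouched vertices blocked for `a` or `b`
(`breakerHolds_of_cherry`). If Maker wastes a move on both sides, her remaining moves have to match
the untouched vertices perfectly, and Breaker claims the last such pair
(`breakerHolds_of_card_le`).

**Maker wins within `n + 2` moves.** Maker builds a matching of `n - 1` edges without wasting a
move. The last two vertices `u` and `x` are then connected by an augmenting path with at most three
new edges, the last of which Maker can choose in two ways (`makerWins_three`); for this, `u` and
`x` must have few blocked pairs. With `k` unmatched vertices in each part, let `e` be the number of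
blocked pairs among them. Breaker raises `e` by one in a move, and Maker lowers it by the sum of
the degrees (in the graph of blocked pairs) of the vertices that she matches. If that sum is at
least the average `2 * e / k`, up to a constant, then `e / (k * (k - 1)) - 1 / k` is essentially
non-increasing, so that `e`, at most `d * n` at the start, falls to little more than `k` once `k`
is a small fraction of `n`; this is `makerWins_of_dense`, in which Maker also matches at once every
vertex that has collected many blocked pairs, of which there is only a bounded number. The excess
`e - k` is then reduced to zero one by one (`makerWins_of_card_restr_le_add`), and `e ≤ k` can be
kept down to `k = 1` (`makerWins_of_card_restr_le`).
-/

namespace MatchingGame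

open Finset

set_option linter.unusedSectionVars false

/-! ### The game on pairs, and its translation into strategies -/

variable {α β : Type*}

/-- The set `M` of pairs contains the graph of a bijection, that is, a perfect matching of the
complete bipartite graph with parts `α` and `β`. -/
def HasPM (M : Finset (α × β)) : Prop := ∃ f : α ≃ β, ∀ a, (a, f a) ∈ M

/-- Transposing a set of pairs keeps its perfect matchings. -/
theorem hasPM_map_prodComm {H : Finset (α × β)} (h : HasPM H) :
    HasPM (H.map (Equiv.prodComm α β).toEmbedding) := by
  obtain ⟨f, hf⟩ := h
  refine ⟨f.symm, fun b => ?_⟩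
  have := hf (f.symm b)
  simpa using this

/-- Maker, owning the pairs in `M`, wins within `r` further moves when Breaker is to move and the
pairs in `N` are blocked (missing from the board or claimed by Breaker). Breaker's move enlarges
`N` by at most one pair; letting him pass makes the notion a little stronger than needed. -/
def MakerWins [DecidableEq α] [DecidableEq β] :
    ℕ → Finset (α × β) → Finset (α × β) → Prop
  | 0, _, M => HasPM M
  | r + 1, N, M => HasPM M ∨ ∀ N', N ⊆ N' → #N' ≤ #N + 1 → Disjoint N' M →
      ∃ e, e ∉ N' ∧ e ∉ M ∧ MakerWins r N' (insert e M)

/-- Breaker, to move, can keep Maker from owning a perfect matching during her next `r` moves,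
where `N` is the set of blocked pairs and `H` is the set of Maker's pairs. Breaker names a pair `e`
to be blocked; since it may be blocked already, in which case he claims some other pair, the
new set `N'` of blocked pairs is any set containing `N` and `e`. Maker may pass. -/
def BreakerHolds [DecidableEq α] [DecidableEq β] :
    ℕ → Finset (α × β) → Finset (α × β) → Prop
  | 0, _, H => ¬ HasPM H
  | r + 1, N, H => ¬ HasPM H ∧ ∃ e, e ∉ H ∧ ∀ N', insert e N ⊆ N' →
      ∀ e' H', H ⊆ H' → H' ⊆ insert e' H → Disjoint N' H' → BreakerHolds r N' H'

section Bridge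

variable {E : Type*} [Fintype α] [Fintype β] [DecidableEq α] [DecidableEq β]

open Classical in
/-- The pairs that Maker cannot claim: those off the board `X`, and those claimed by Breaker. -/
noncomputable def blocked (ι : α × β → E) (X : Set E) (p : MBPosition E) : Finset (α × β) :=
  univ.filter fun q => ι q ∉ X ∨ ι q ∈ p.breaker

theorem mem_blocked {ι : α × β → E} {X : Set E} {p : MBPosition E} {q : α × β} :
    q ∈ blocked ι X p ↔ ι q ∉ X ∨ ι q ∈ p.breaker := by
  simp [blocked]

theorem mem_blocked_start {ι : α × β → E} {X : Set E} {q : α × β} :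
    q ∈ blocked ι X (MBPosition.start E) ↔ ι q ∉ X := by
  simp [mem_blocked, MBPosition.start]

open Classical in
/-- The pairs claimed by Maker. -/
noncomputable def owned (ι : α × β → E) (p : MBPosition E) : Finset (α × β) :=
  univ.filter fun q => ι q ∈ p.maker

open Classical in
/-- A legal move that leads to a pair in `P` if there is one, and an arbitrary legal move
otherwise. -/
noncomputable def preferredMove (X : Set E) (p : MBPosition E) (P : E → Prop) : Option E :=
  if h : ∃ x, p.Free X x ∧ P x then some h.choose
  else if h : ∃ x, p.Free X x then some h.choose else none

theorem isMBStrategy_preferredMove (X : Set E) (P : MBPosition E → E → Prop) :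
    IsMBStrategy X fun p => preferredMove X p (P p) := by
  intro p
  refine ⟨fun x hx => ?_, fun hx => ?_⟩ <;> simp only [preferredMove] at hx
  · split_ifs at hx with h1 h2
    · obtain rfl := Option.some.inj hx
      exact h1.choose_spec.1
    · obtain rfl := Option.some.inj hx
      exact h2.choose_spec
  · split_ifs at hx with h1 h2
    exact fun x hx => h2 ⟨x, hx⟩

theorem preferredMove_of_exists {X : Set E} {p : MBPosition E} {P : E → Prop}
    (h : ∃ x, p.Free X x ∧ P x) : ∃ x, preferredMove X p P = some x ∧ p.Free X x ∧ P x := by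
  unfold preferredMove
  rw [dif_pos h]
  exact ⟨_, rfl, h.choose_spec⟩

/-- If `ι` identifies pairs with elements of the board and every open perfect matching of pairs
contains a winning set, then a winning value of the game on pairs yields a winning strategy. -/
theorem makerWinsWithin_of_makerWins {ι : α × β → E} (hι : ι.Injective) {X : Set E}
    {F : Set (Set E)} (hF : ∀ f : α ≃ β, (∀ a, ι (a, f a) ∈ X) →
      ∃ W ∈ F, ∀ e ∈ W, ∃ a, e = ι (a, f a)) {m : ℕ}
    (h : MakerWins m (blocked ι X (MBPosition.start E)) ∅) : MakerWinsWithin X F m := by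
  classical
  -- Maker moves to a pair that keeps the game value winning.
  refine ⟨fun p => preferredMove X p fun x => ∃ e, ι e = x ∧
    MakerWins (m - p.maker.length - 1) (blocked ι X p) (insert e (owned ι p)),
    isMBStrategy_preferredMove X _, fun τ hτ => ?_⟩
  set σ : MBPosition E → Option E := fun p => preferredMove X p fun x => ∃ e, ι e = x ∧
    MakerWins (m - p.maker.length - 1) (blocked ι X p) (insert e (owned ι p)) with hσ
  have win : ∀ j ≤ m, (∀ e ∈ owned ι (mbPlay τ σ j), ι e ∈ X) →
      HasPM (owned ι (mbPlay τ σ j)) →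
      ∃ j ≤ m, ∃ W ∈ F, ∀ e ∈ W, e ∈ (mbPlay τ σ j).maker := by
    rintro j hj hX ⟨f, hf⟩
    obtain ⟨W, hW, hWf⟩ := hF f fun a => hX _ (hf a)
    refine ⟨j, hj, W, hW, fun e he => ?_⟩
    obtain ⟨a, rfl⟩ := hWf e he
    simpa [owned] using hf a
  by_contra hno
  have key : ∀ j ≤ m, (mbPlay τ σ j).maker.length = j ∧
      Disjoint (blocked ι X (mbPlay τ σ j)) (owned ι (mbPlay τ σ j)) ∧
      MakerWins (m - j) (blocked ι X (mbPlay τ σ j)) (owned ι (mbPlay τ σ j)) := by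
    intro j
    induction j with
    | zero =>
      intro _
      have h0 : owned ι (mbPlay τ σ 0) = ∅ := by simp [owned, mbPlay, MBPosition.start]
      rw [h0]
      exact ⟨rfl, disjoint_empty_right _, h⟩
    | succ j ih =>
      intro hj
      obtain ⟨hlen, hdis, hwin⟩ := ih (by omega)
      have hX : ∀ e ∈ owned ι (mbPlay τ σ j), ι e ∈ X := by
        intro e he
        have := Finset.disjoint_right.1 hdis he
        simp only [blocked, mem_filter, mem_univ, true_and, not_or, not_not] at this
        exact this.1
      have hnp : ¬ HasPM (owned ι (mbPlay τ σ j)) := fun hp => hno (win j (by omega) hX hp)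
      obtain ⟨r, hr⟩ : ∃ r, m - j = r + 1 := ⟨m - j - 1, by omega⟩
      rw [hr] at hwin
      replace hwin := hwin.resolve_left hnp
      set p := mbPlay τ σ j with hp
      set q : MBPosition E := ⟨(τ p).toList ++ p.breaker, p.maker⟩ with hq
      have hstep : mbPlay τ σ (j + 1) = ⟨q.breaker, (σ q).toList ++ q.maker⟩ := rfl
      have hown : owned ι q = owned ι p := rfl
      have hsub : blocked ι X p ⊆ blocked ι X q := by
        intro e
        simp only [blocked, mem_filter, mem_univ, true_and, hq, List.mem_append]
        tauto
      have hτp := hτ p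
      have hcard : #(blocked ι X q) ≤ #(blocked ι X p) + 1 := by
        cases hb : τ p with
        | none => simp [blocked, hq, hb]
        | some b =>
          by_cases hbr : ∃ e, ι e = b
          · obtain ⟨e, rfl⟩ := hbr
            refine (card_le_card (t := insert e (blocked ι X p)) ?_).trans (card_insert_le _ _)
            intro e'
            simp only [blocked, mem_filter, mem_univ, true_and, hq, hb, Option.toList_some,
              List.mem_append, List.mem_singleton, mem_insert, hι.eq_iff]
            tauto
          · refine (card_le_card ?_).trans (Nat.le_succ _)
            intro e'
            have : ι e' ≠ b := fun h => hbr ⟨e', h⟩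
            simp only [blocked, mem_filter, mem_univ, true_and, hq, hb, Option.toList_some,
              List.mem_append, List.mem_singleton, this, false_or]
            exact id
      have hdis' : Disjoint (blocked ι X q) (owned ι p) := by
        rw [Finset.disjoint_right] at hdis ⊢
        intro e he hbe
        have h1 := hdis he
        simp only [blocked, mem_filter, mem_univ, true_and, hq, List.mem_append,
          not_or] at h1 hbe
        rcases hbe with hbe | hbe | hbe
        · exact h1.1 hbe
        · have := (hτp.1 (ι e) (by simpa using hbe)).2.2
          exact this (by simpa [owned] using he)
        · exact h1.2 hbe
      obtain ⟨e, heN, heM, hwe⟩ := hwin _ hsub hcard hdis'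
      have hfree : q.Free X (ι e) := by
        simp only [blocked, mem_filter, mem_univ, true_and, not_or, not_not] at heN
        exact ⟨heN.1, heN.2, by simpa [owned] using heM⟩
      have hlq : m - q.maker.length - 1 = r := by
        have : q.maker.length = j := hlen
        omega
      obtain ⟨x, hx, hxf, e', rfl, he'⟩ := preferredMove_of_exists (X := X) (p := q)
        (P := fun x => ∃ e, ι e = x ∧
          MakerWins (m - q.maker.length - 1) (blocked ι X q) (insert e (owned ι q)))
        ⟨ι e, hfree, e, rfl, by rw [hlq]; exact hwe⟩
      rw [hlq] at he'
      have hσq : σ q = some (ι e') := hx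
      have hown' : owned ι (mbPlay τ σ (j + 1)) = insert e' (owned ι q) := by
        ext a
        simp [owned, hstep, hσq, hι.eq_iff]
      have hbl' : blocked ι X (mbPlay τ σ (j + 1)) = blocked ι X q := rfl
      rw [hown', hbl']
      refine ⟨by rw [hstep, hσq]; simp [hq, hlen], ?_, ?_⟩
      · rw [Finset.disjoint_insert_right]
        refine ⟨?_, hdis'⟩
        simp only [blocked, mem_filter, mem_univ, true_and, not_or, not_not]
        exact ⟨hxf.1, hxf.2.1⟩
      · have : m - (j + 1) = r := by omega
        rw [this]
        exact he'
  obtain ⟨-, hdis, hwin⟩ := key m le_rfl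
  rw [Nat.sub_self] at hwin
  refine hno (win m le_rfl ?_ hwin)
  intro e he
  have := Finset.disjoint_right.1 hdis he
  simp only [blocked, mem_filter, mem_univ, true_and, not_or, not_not] at this
  exact this.1

/-- If `ι` identifies pairs with elements of the board and every winning set contains a perfect
matching of pairs, then Breaker's holding the game on pairs refutes every strategy of Maker. -/
theorem not_makerWinsWithin_of_breakerHolds {ι : α × β → E} (hι : ι.Injective) {X : Set E}
    (hX : ∀ x ∈ X, ∃ e, ι e = x)
    {F : Set (Set E)} (hF : ∀ W ∈ F, ∃ f : α ≃ β, ∀ a, ι (a, f a) ∈ W) {m : ℕ}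
    (h : BreakerHolds m (blocked ι X (MBPosition.start E)) ∅) : ¬ MakerWinsWithin X F m := by
  classical
  rintro ⟨σ, hσ, hwin⟩
  -- Breaker claims a pair after which he still holds, or anything if that pair is blocked already.
  set P : MBPosition E → E → Prop := fun p x => ∃ e, ι e = x ∧ ∀ N',
    insert e (blocked ι X p) ⊆ N' → ∀ e' H', owned ι p ⊆ H' → H' ⊆ insert e' (owned ι p) →
      Disjoint N' H' → BreakerHolds (m - p.breaker.length - 1) N' H' with hP
  set τ : MBPosition E → Option E := fun p => preferredMove X p (P p) with hτdef
  have hτ : IsMBStrategy X τ := isMBStrategy_preferredMove X P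
  -- The moves left are counted by Breaker's moves: once the board is full, nobody moves any more.
  have key : ∀ j ≤ m, (mbPlay τ σ j).breaker.length ≤ j ∧
      Disjoint (blocked ι X (mbPlay τ σ j)) (owned ι (mbPlay τ σ j)) ∧
      BreakerHolds (m - (mbPlay τ σ j).breaker.length) (blocked ι X (mbPlay τ σ j))
        (owned ι (mbPlay τ σ j)) := by
    intro j
    induction j with
    | zero =>
      intro _
      have h0 : owned ι (mbPlay τ σ 0) = ∅ := by simp [owned, mbPlay, MBPosition.start]
      rw [h0]
      exact ⟨Nat.zero_le _, disjoint_empty_right _, h⟩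
    | succ j ih =>
      intro hj
      obtain ⟨hlen, hdis, hbr⟩ := ih (by omega)
      set p := mbPlay τ σ j with hp
      set q : MBPosition E := ⟨(τ p).toList ++ p.breaker, p.maker⟩ with hq
      have hstep : mbPlay τ σ (j + 1) = ⟨q.breaker, (σ q).toList ++ q.maker⟩ := rfl
      have hσq := hσ q
      cases hb : τ p with
      | none =>
        have hnf := (hτ p).2 hb
        have hqp : q = p := by simp [hq, hb]
        have hσn : σ q = none := by
          cases hs : σ q with
          | none => rfl
          | some x => exact absurd (hqp ▸ hσq.1 x hs) (hnf x)
        have : mbPlay τ σ (j + 1) = p := by rw [hstep, hσn, hqp]; rfl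
        rw [this]
        exact ⟨by omega, hdis, hbr⟩
      | some b =>
        have hbf := (hτ p).1 b hb
        obtain ⟨r, hr⟩ : ∃ r, m - p.breaker.length = r + 1 :=
          ⟨m - p.breaker.length - 1, by omega⟩
        rw [hr] at hbr
        obtain ⟨-, e, heH, hcont⟩ := hbr
        have hr' : m - p.breaker.length - 1 = r := by omega
        have hqb : q.breaker = b :: p.breaker := by simp [hq, hb]
        have hcont' : ∃ e, insert e (blocked ι X p) ⊆ blocked ι X q ∧
            ∀ N', insert e (blocked ι X p) ⊆ N' → ∀ e' H', owned ι p ⊆ H' →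
            H' ⊆ insert e' (owned ι p) → Disjoint N' H' → BreakerHolds r N' H' := by
          have hsub : blocked ι X p ⊆ blocked ι X q := by
            intro e
            simp only [blocked, mem_filter, mem_univ, true_and, hqb, List.mem_cons]
            tauto
          by_cases hfree : p.Free X (ι e)
          · obtain ⟨x, hx, -, e', rfl, he'⟩ := preferredMove_of_exists (X := X) (p := p)
              (P := P p) ⟨ι e, hfree, e, rfl, by rw [hr']; exact hcont⟩
            rw [hr'] at he'
            have hbe : b = ι e' := by
              have : τ p = some (ι e') := hx
              rw [hb] at this
              exact Option.some.inj this
            refine ⟨e', insert_subset ?_ hsub, he'⟩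
            simp [blocked, hqb, hbe]
          · refine ⟨e, insert_subset (hsub ?_) hsub, hcont⟩
            have h1 : ι e ∉ p.maker := by simpa [owned] using heH
            simp only [blocked, mem_filter, mem_univ, true_and]
            by_contra hc
            push Not at hc
            exact hfree ⟨hc.1, hc.2, h1⟩
        obtain ⟨e, hsub, hcont⟩ := hcont'
        have hbl' : blocked ι X (mbPlay τ σ (j + 1)) = blocked ι X q := rfl
        have hlen' : (mbPlay τ σ (j + 1)).breaker.length = p.breaker.length + 1 := by
          rw [hstep, hqb]; rfl
        have hdq : Disjoint (blocked ι X q) (owned ι p) := by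
          rw [Finset.disjoint_right] at hdis ⊢
          intro e he hbe
          have h1 := hdis he
          simp only [blocked, mem_filter, mem_univ, true_and, hqb, List.mem_cons,
            not_or] at h1 hbe
          rcases hbe with hbe | hbe | hbe
          · exact h1.1 hbe
          · exact hbf.2.2 (by simpa [owned, hbe] using he)
          · exact h1.2 hbe
        have hmain : ∃ e', owned ι p ⊆ owned ι (mbPlay τ σ (j + 1)) ∧
            owned ι (mbPlay τ σ (j + 1)) ⊆ insert e' (owned ι p) ∧
            Disjoint (blocked ι X q) (owned ι (mbPlay τ σ (j + 1))) := by
          cases hs : σ q with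
          | none =>
            have : owned ι (mbPlay τ σ (j + 1)) = owned ι p := by
              rw [hstep, hs]; rfl
            rw [this]
            exact ⟨e, subset_rfl, subset_insert _ _, hdq⟩
          | some x =>
            have hxf := hσq.1 x hs
            obtain ⟨e', rfl⟩ := hX x hxf.1
            have : owned ι (mbPlay τ σ (j + 1)) = insert e' (owned ι p) := by
              have hmk : (mbPlay τ σ (j + 1)).maker = ι e' :: p.maker := by rw [hstep, hs]; rfl
              ext a
              simp [owned, hmk, hι.eq_iff]
            rw [this]
            refine ⟨e', subset_insert _ _, subset_rfl, ?_⟩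
            rw [Finset.disjoint_insert_right]
            refine ⟨?_, hdq⟩
            simp only [blocked, mem_filter, mem_univ, true_and, not_or, not_not]
            exact ⟨hxf.1, hxf.2.1⟩
        obtain ⟨e', h1, h2, h3⟩ := hmain
        rw [hbl', hlen']
        refine ⟨by omega, h3, ?_⟩
        have : m - (p.breaker.length + 1) = r := by omega
        rw [this]
        exact hcont _ hsub e' _ h1 h2 h3
  obtain ⟨j, hj, W, hW, hWj⟩ := hwin τ hτ
  obtain ⟨f, hf⟩ := hF W hW
  obtain ⟨-, -, hbr⟩ := key j hj
  have hpm : HasPM (owned ι (mbPlay τ σ j)) := ⟨f, fun a => by simpa [owned] using hWj _ (hf a)⟩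
  cases hr : m - (mbPlay τ σ j).breaker.length with
  | zero => rw [hr] at hbr; exact hbr hpm
  | succ r => rw [hr] at hbr; exact hbr.1 hpm

end Bridge

/-! ### Breaker holds on the complete bipartite graph minus a perfect matching -/

section Breaker

variable {α β : Type*} [Fintype α] [Fintype β] [DecidableEq α] [DecidableEq β]

/-- The rows that lie in no pair of `H`. -/
def isoRows (H : Finset (α × β)) : Finset α := univ.filter fun a => ∀ b, (a, b) ∉ H

/-- The columns that lie in no pair of `H`. -/
def isoCols (H : Finset (α × β)) : Finset β := univ.filter fun b => ∀ a, (a, b) ∉ H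

theorem mem_isoRows {H : Finset (α × β)} {a : α} : a ∈ isoRows H ↔ ∀ b, (a, b) ∉ H := by
  simp [isoRows]

theorem mem_isoCols {H : Finset (α × β)} {b : β} : b ∈ isoCols H ↔ ∀ a, (a, b) ∉ H := by
  simp [isoCols]

theorem not_hasPM_of_mem_isoRows {H : Finset (α × β)} {a : α} (h : a ∈ isoRows H) :
    ¬ HasPM H := fun ⟨_, hf⟩ => mem_isoRows.1 h _ (hf a)

theorem not_hasPM_of_mem_isoCols {H : Finset (α × β)} {b : β} (h : b ∈ isoCols H) :
    ¬ HasPM H := fun ⟨f, hf⟩ => mem_isoCols.1 h (f.symm b) (by simpa using hf (f.symm b))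

theorem erase_isoRows_subset {H H' : Finset (α × β)} {e : α × β} (h : H' ⊆ insert e H) :
    (isoRows H).erase e.1 ⊆ isoRows H' := by
  intro a ha
  rw [mem_erase, mem_isoRows] at ha
  rw [mem_isoRows]
  intro b hb
  rcases mem_insert.1 (h hb) with h1 | h1
  · exact ha.1 (by rw [← h1])
  · exact ha.2 b h1

theorem erase_isoCols_subset {H H' : Finset (α × β)} {e : α × β} (h : H' ⊆ insert e H) :
    (isoCols H).erase e.2 ⊆ isoCols H' := by
  intro a ha
  rw [mem_erase, mem_isoCols] at ha
  rw [mem_isoCols]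
  intro b hb
  rcases mem_insert.1 (h hb) with h1 | h1
  · exact ha.1 (by rw [← h1])
  · exact ha.2 b h1

theorem card_isoRows_le {H H' : Finset (α × β)} {e : α × β} (h : H' ⊆ insert e H) :
    #(isoRows H) ≤ #(isoRows H') + 1 := by
  have h1 := card_le_card (erase_isoRows_subset h)
  have h2 := pred_card_le_card_erase (s := isoRows H) (a := e.1)
  omega

theorem card_isoCols_le {H H' : Finset (α × β)} {e : α × β} (h : H' ⊆ insert e H) :
    #(isoCols H) ≤ #(isoCols H') + 1 := by
  have h1 := card_le_card (erase_isoCols_subset h)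
  have h2 := pred_card_le_card_erase (s := isoCols H) (a := e.2)
  omega

theorem BreakerHolds.swap {r : ℕ} {N H : Finset (α × β)}
    (h : BreakerHolds r (N.map (Equiv.prodComm α β).toEmbedding)
      (H.map (Equiv.prodComm α β).toEmbedding)) : BreakerHolds r N H := by
  induction r generalizing N H with
  | zero => exact fun hp => h (hasPM_map_prodComm hp)
  | succ r ih =>
    refine ⟨fun hp => h.1 (hasPM_map_prodComm hp), ?_⟩
    obtain ⟨-, e, he, hc⟩ := h
    refine ⟨e.swap, fun h' => he ?_, fun N' hN' e' H' h1 h2 h3 => ih ?_⟩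
    · rw [mem_map_equiv]; exact h'
    · refine hc _ ?_ e'.swap _ (map_subset_map.2 h1) ?_ ?_
      · intro x hx
        rw [mem_map_equiv]
        apply hN'
        rw [mem_insert] at hx ⊢
        rcases hx with rfl | hx
        · exact Or.inl rfl
        · exact Or.inr (by rwa [mem_map_equiv] at hx)
      · intro x hx
        rw [mem_map_equiv] at hx
        have := h2 hx
        rw [mem_insert] at this ⊢
        rcases this with h' | h'
        · left; rw [← h']; rfl
        · right; rwa [mem_map_equiv]
      · exact (disjoint_map _).2 h3

theorem isoRows_swap (H : Finset (α × β)) :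
    isoRows (H.map (Equiv.prodComm α β).toEmbedding) = isoCols H := by
  ext b; simp [mem_isoRows, mem_isoCols]

theorem isoCols_swap (H : Finset (α × β)) :
    isoCols (H.map (Equiv.prodComm α β).toEmbedding) = isoRows H := by
  ext b; simp [mem_isoRows, mem_isoCols]

/-- If Maker needs all her remaining moves to reach the untouched rows, and likewise for the
untouched columns, then Breaker only has to claim her unique last pair. -/
theorem breakerHolds_of_card_le {r : ℕ} (hr : 1 ≤ r) {N H : Finset (α × β)}
    (hS : r ≤ #(isoRows H)) (hT : r ≤ #(isoCols H)) : BreakerHolds r N H := by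
  induction r, hr using Nat.le_induction generalizing N H with
  | base =>
    obtain ⟨u, hu⟩ := card_pos.1 hS
    obtain ⟨x, hx⟩ := card_pos.1 hT
    refine ⟨not_hasPM_of_mem_isoRows hu, (u, x), mem_isoRows.1 hu x,
      fun N' hN' e' H' h1 h2 h3 => ?_⟩
    by_cases h : e'.1 = u
    · refine not_hasPM_of_mem_isoCols (b := x) ?_
      rw [mem_isoCols]
      intro a ha
      rcases mem_insert.1 (h2 ha) with h' | h'
      · have h4 : (u, x) ∈ H' := by rw [← h, ← h'] ; exact ha
        exact Finset.disjoint_left.1 h3 (hN' (mem_insert_self _ _)) h4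
      · exact mem_isoCols.1 hx a h'
    · exact not_hasPM_of_mem_isoRows
        (erase_isoRows_subset h2 (mem_erase.2 ⟨fun h' => h h'.symm, hu⟩))
  | succ r hr ih =>
    obtain ⟨u, hu⟩ := card_pos.1 (by omega : 0 < #(isoRows H))
    obtain ⟨x, hx⟩ := card_pos.1 (by omega : 0 < #(isoCols H))
    refine ⟨not_hasPM_of_mem_isoRows hu, (u, x), mem_isoRows.1 hu x,
      fun N' hN' e' H' h1 h2 h3 => ih ?_ ?_⟩
    · have := card_isoRows_le h2; omega
    · have := card_isoCols_le h2; omega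

/-- Maker has spent her spare move on a second pair in the column `y`, so the rows `a` and `b` are
both waiting for a column, and one untouched column is to be matched with `a` or `b`. Breaker keeps
two untouched columns blocked for `a` or `b`, so that Maker never gets a double threat. -/
theorem breakerHolds_of_cherry {r : ℕ} (hr : 1 ≤ r) {N H : Finset (α × β)} {a b : α} {y : β}
    (hab : a ≠ b) (ha : ∀ z, (a, z) ∈ H ↔ z = y) (hb : ∀ z, (b, z) ∈ H ↔ z = y)
    (hT : r ≤ #(isoCols H)) (hS : r ≤ #(isoRows H) + 1)
    (hx : ∃ x ∈ isoCols H, (a, x) ∈ N ∨ (b, x) ∈ N) : BreakerHolds r N H := by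
  induction r, hr using Nat.le_induction generalizing N H with
  | base =>
    obtain ⟨x, hxT, hxN⟩ := hx
    -- the leaf whose pair with `x` Breaker still has to claim
    obtain ⟨c, hcx, hcov⟩ : ∃ c : α, (c, x) ∉ H ∧
        ∀ N' : Finset (α × β), insert (c, x) N ⊆ N' → (a, x) ∈ N' ∧ (b, x) ∈ N' := by
      rcases hxN with h | h
      · exact ⟨b, mem_isoCols.1 hxT b, fun N' h' =>
          ⟨h' (mem_insert_of_mem h), h' (mem_insert_self _ _)⟩⟩
      · exact ⟨a, mem_isoCols.1 hxT a, fun N' h' =>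
          ⟨h' (mem_insert_self _ _), h' (mem_insert_of_mem h)⟩⟩
    refine ⟨not_hasPM_of_mem_isoCols hxT, (c, x), hcx, fun N' hN' e' H' h1 h2 h3 => ?_⟩
    obtain ⟨hax, hbx⟩ := hcov N' hN'
    rintro ⟨f, hf⟩
    obtain ⟨w, rfl⟩ := f.surjective x
    have hw : (w, f w) = e' :=
      (mem_insert.1 (h2 (hf w))).resolve_right (mem_isoCols.1 hxT w)
    have hwa : w ≠ a := fun h => Finset.disjoint_left.1 h3 hax (h ▸ hf w)
    have hwb : w ≠ b := fun h => Finset.disjoint_left.1 h3 hbx (h ▸ hf w)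
    have hfa : f a = y := by
      rcases mem_insert.1 (h2 (hf a)) with h | h
      · exact absurd (congrArg Prod.fst (hw.trans h.symm)) hwa
      · exact (ha _).1 h
    have hfb : f b = y := by
      rcases mem_insert.1 (h2 (hf b)) with h | h
      · exact absurd (congrArg Prod.fst (hw.trans h.symm)) hwb
      · exact (hb _).1 h
    exact hab (f.injective (hfa.trans hfb.symm))
  | succ r hr ih =>
    obtain ⟨x, hxT, hxN⟩ := hx
    obtain ⟨x₂, hx₂T, hne⟩ := exists_mem_ne (by omega : 1 < #(isoCols H)) x
    refine ⟨not_hasPM_of_mem_isoCols hxT, (a, x₂), mem_isoCols.1 hx₂T a,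
      fun N' hN' e' H' h1 h2 h3 => ?_⟩
    have hrow := card_isoRows_le h2
    have hcol := card_isoCols_le h2
    -- A move outside the untouched rows is a second spare move, on the side of the rows.
    by_cases hw : e'.1 ∈ isoRows H
    · have hleaf : ∀ c, (∀ z, (c, z) ∈ H ↔ z = y) → ∀ z, (c, z) ∈ H' ↔ z = y := by
        intro c hc z
        refine ⟨fun h => ?_, fun h => h1 ((hc z).2 h)⟩
        rcases mem_insert.1 (h2 h) with h' | h'
        · rw [← h'] at hw
          exact absurd ((hc y).2 rfl) (mem_isoRows.1 hw y)
        · exact (hc z).1 h'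
      refine ih (hleaf a ha) (hleaf b hb) (by omega) (by omega) ?_
      by_cases hz : e'.2 = x
      · exact ⟨x₂, erase_isoCols_subset h2 (mem_erase.2 ⟨by rw [hz]; exact hne, hx₂T⟩),
          Or.inl (hN' (mem_insert_self _ _))⟩
      · exact ⟨x, erase_isoCols_subset h2 (mem_erase.2 ⟨fun h => hz h.symm, hxT⟩),
          hxN.imp (fun h => hN' (mem_insert_of_mem h)) fun h => hN' (mem_insert_of_mem h)⟩
    · refine breakerHolds_of_card_le hr ?_ (by omega)
      have h4 := card_le_card (erase_isoRows_subset h2)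
      rw [erase_eq_of_notMem hw] at h4
      omega

/-- The transposed form of `breakerHolds_of_cherry`: the spare move gave the row `a` a second
column. -/
theorem breakerHolds_of_cherry' {r : ℕ} (hr : 1 ≤ r) {N H : Finset (α × β)} {y z : β} {a : α}
    (hyz : y ≠ z) (hy : ∀ c, (c, y) ∈ H ↔ c = a) (hz : ∀ c, (c, z) ∈ H ↔ c = a)
    (hS : r ≤ #(isoRows H)) (hT : r ≤ #(isoCols H) + 1)
    (hx : ∃ u ∈ isoRows H, (u, y) ∈ N ∨ (u, z) ∈ N) : BreakerHolds r N H := by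
  refine BreakerHolds.swap (breakerHolds_of_cherry (y := a) hr hyz ?_ ?_ ?_ ?_ ?_)
  · intro c; rw [mem_map_equiv]; exact hy c
  · intro c; rw [mem_map_equiv]; exact hz c
  · rwa [isoCols_swap]
  · rwa [isoRows_swap]
  · obtain ⟨u, hu, h⟩ := hx
    refine ⟨u, by rwa [isoCols_swap], ?_⟩
    simpa using h

/-- As long as Maker's pairs form a matching, Breaker keeps a perfect matching `m` of blocked
pairs between the untouched rows and columns. A move of Maker breaks it in at most one
place `s`, which Breaker repairs at once. -/
theorem breakerHolds_of_matching {r : ℕ} {N H : Finset (α × β)}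
    (hrow : ∀ a y z, (a, y) ∈ H → (a, z) ∈ H → y = z)
    (hcol : ∀ a b y, (a, y) ∈ H → (b, y) ∈ H → a = b)
    (m : α ≃ β) (hm : ∀ a, a ∈ isoRows H ↔ m a ∈ isoCols H) (s : α) (hs : s ∈ isoRows H)
    (hN : ∀ a ∈ isoRows H, a ≠ s → (a, m a) ∈ N) (hr : r ≤ #(isoRows H) + 1) :
    BreakerHolds r N H := by
  have hST : #(isoRows H) = #(isoCols H) := by
    refine card_bij (fun a _ => m a) (fun a ha => (hm a).1 ha) (fun a _ b _ h => m.injective h)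
      fun b hb => ⟨m.symm b, (hm _).2 (by simpa using hb), by simp⟩
  induction r generalizing N H m s with
  | zero => exact not_hasPM_of_mem_isoRows hs
  | succ r ih =>
    refine ⟨not_hasPM_of_mem_isoRows hs, (s, m s), mem_isoRows.1 hs _,
      fun N' hN' e' H' h1 h2 h3 => ?_⟩
    replace hN : ∀ a ∈ isoRows H, (a, m a) ∈ N' := by
      intro a ha
      by_cases h : a = s
      · subst h; exact hN' (mem_insert_self _ _)
      · exact hN' (mem_insert_of_mem (hN a ha h))
    by_cases he : e' ∈ H'
    swap
    · have : H' = H := by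
        refine Subset.antisymm (fun x hx => ?_) h1
        exact (mem_insert.1 (h2 hx)).resolve_left fun h => he (h ▸ hx)
      subst this
      exact ih hrow hcol m hm s hs (fun a ha _ => hN a ha) (by omega) hST
    have hH' : H' = insert e' H := Subset.antisymm h2 (insert_subset he h1)
    clear h1 h2
    subst hH'
    obtain ⟨w, z⟩ := e'
    have hwz : (w, z) ∉ N' := Finset.disjoint_right.1 h3 (mem_insert_self _ _)
    have hR : #(isoRows H) ≤ #(isoRows (insert (w, z) H)) + 1 := card_isoRows_le subset_rfl
    have hC : #(isoCols H) ≤ #(isoCols (insert (w, z) H)) + 1 := card_isoCols_le subset_rfl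
    have hRe : (isoRows H).erase w ⊆ isoRows (insert (w, z) H) :=
      erase_isoRows_subset (e := (w, z)) subset_rfl
    have hCe : (isoCols H).erase z ⊆ isoCols (insert (w, z) H) :=
      erase_isoCols_subset (e := (w, z)) subset_rfl
    by_cases hw : w ∈ isoRows H <;> by_cases hz : z ∈ isoCols H
    -- Maker extends her matching; the partners of `w` and `z` under `m` become partners.
    · have hmw : m w ≠ z := fun h => hwz (h ▸ hN w hw)
      have hR' : isoRows (insert (w, z) H) = (isoRows H).erase w := by
        refine Subset.antisymm (fun a ha => ?_) hRe
        rw [mem_isoRows] at ha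
        refine mem_erase.2 ⟨?_, mem_isoRows.2 fun b hb => ha b (mem_insert_of_mem hb)⟩
        rintro rfl
        exact ha z (mem_insert_self _ _)
      have hC' : isoCols (insert (w, z) H) = (isoCols H).erase z := by
        refine Subset.antisymm (fun a ha => ?_) hCe
        rw [mem_isoCols] at ha
        refine mem_erase.2 ⟨?_, mem_isoCols.2 fun b hb => ha b (mem_insert_of_mem hb)⟩
        rintro rfl
        exact ha w (mem_insert_self _ _)
      set t := m.symm z with ht
      have htw : t ≠ w := fun h => hmw (by rw [← h, ht]; simp)
      have htS : t ∈ isoRows H := (hm t).2 (by rw [ht]; simpa using hz)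
      have hm' : ∀ a, a ∈ isoRows (insert (w, z) H) ↔
          ((Equiv.swap w t).trans m) a ∈ isoCols (insert (w, z) H) := by
        intro a
        rw [hR', hC', mem_erase, mem_erase, Equiv.trans_apply]
        by_cases haw : a = w
        · subst haw
          simp [Equiv.swap_apply_left, ht]
        by_cases hat : a = t
        · rw [hat, Equiv.swap_apply_right]
          exact ⟨fun _ => ⟨hmw, (hm w).1 hw⟩, fun _ => ⟨htw, htS⟩⟩
        · rw [Equiv.swap_apply_of_ne_of_ne haw hat, hm a]
          have : m a ≠ z := fun h => hat (by rw [ht, ← h]; simp)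
          tauto
      refine ih ?_ ?_ ((Equiv.swap w t).trans m) hm' t ?_ ?_ (by omega) ?_
      · intro a y y' hy hy'
        rw [mem_insert, Prod.mk.injEq] at hy hy'
        rcases hy with ⟨rfl, rfl⟩ | hy <;> rcases hy' with ⟨h', rfl⟩ | hy'
        · rfl
        · exact absurd hy' (mem_isoRows.1 hw _)
        · subst h'; exact absurd hy (mem_isoRows.1 hw _)
        · exact hrow _ _ _ hy hy'
      · intro a a' y hy hy'
        rw [mem_insert, Prod.mk.injEq] at hy hy'
        rcases hy with ⟨rfl, rfl⟩ | hy <;> rcases hy' with ⟨rfl, h'⟩ | hy'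
        · rfl
        · exact absurd hy' (mem_isoCols.1 hz _)
        · subst h'; exact absurd hy (mem_isoCols.1 hz _)
        · exact hcol _ _ _ hy hy'
      · rw [hR']; exact mem_erase.2 ⟨htw, htS⟩
      · intro a ha hat
        rw [hR', mem_erase] at ha
        rw [Equiv.trans_apply, Equiv.swap_apply_of_ne_of_ne ha.1 hat]
        exact hN a ha.2
      · rw [hR', hC', card_erase_of_mem hw, card_erase_of_mem hz, hST]
    -- Maker claims a second pair in the column `z`, whose leaf `w` is blocked to `m w`.
    · have hmw : m w ∈ isoCols (insert (w, z) H) :=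
        hCe (mem_erase.2 ⟨fun h => hz (h ▸ (hm w).1 hw), (hm w).1 hw⟩)
      rcases Nat.eq_zero_or_pos r with rfl | hr0
      · exact not_hasPM_of_mem_isoCols hmw
      rw [erase_eq_of_notMem hz] at hCe
      have hC2 := card_le_card hCe
      obtain ⟨b, hb⟩ : ∃ b, (b, z) ∈ H := by
        simpa [mem_isoCols] using hz
      have hwb : w ≠ b := fun h => mem_isoRows.1 hw z (h ▸ hb)
      refine breakerHolds_of_cherry hr0 hwb (y := z) ?_ ?_ (by omega) (by omega)
        ⟨m w, hmw, Or.inl (hN w hw)⟩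
      · intro y
        rw [mem_insert, Prod.mk.injEq]
        exact ⟨fun h => h.elim (fun h => h.2) fun h => absurd h (mem_isoRows.1 hw y),
          fun h => Or.inl ⟨rfl, h⟩⟩
      · intro y
        rw [mem_insert, Prod.mk.injEq]
        exact ⟨fun h => h.elim (fun h => h.2) fun h => hrow _ _ _ h hb,
          fun h => Or.inr (h ▸ hb)⟩
    -- Maker claims a second pair in the row `w`.
    · set u := m.symm z with hu
      have hmu : m u = z := by simp [hu]
      have huS : u ∈ isoRows H := (hm u).2 (hmu ▸ hz)
      have huS' : u ∈ isoRows (insert (w, z) H) :=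
        hRe (mem_erase.2 ⟨fun h => hw (h ▸ huS), huS⟩)
      rcases Nat.eq_zero_or_pos r with rfl | hr0
      · exact not_hasPM_of_mem_isoRows huS'
      rw [erase_eq_of_notMem hw] at hRe
      have hR2 := card_le_card hRe
      obtain ⟨y, hy⟩ : ∃ y, (w, y) ∈ H := by
        simpa [mem_isoRows] using hw
      have hzy : z ≠ y := fun h => mem_isoCols.1 hz w (h ▸ hy)
      refine breakerHolds_of_cherry' hr0 hzy (a := w) ?_ ?_ (by omega) (by omega)
        ⟨u, huS', Or.inl (hmu ▸ hN u huS)⟩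
      · intro c
        rw [mem_insert, Prod.mk.injEq]
        exact ⟨fun h => h.elim (fun h => h.1) fun h => absurd h (mem_isoCols.1 hz c),
          fun h => Or.inl ⟨h, rfl⟩⟩
      · intro c
        rw [mem_insert, Prod.mk.injEq]
        exact ⟨fun h => h.elim (fun h => h.1) fun h => hcol _ _ _ h hy,
          fun h => Or.inr (h ▸ hy)⟩
    -- Maker reaches no untouched vertex, so from now on every move has to reach one on each side.
    · rw [erase_eq_of_notMem hw] at hRe
      rw [erase_eq_of_notMem hz] at hCe
      have hR2 := card_le_card hRe
      have hC2 := card_le_card hCe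
      rcases Nat.eq_zero_or_pos r with rfl | hr0
      · exact not_hasPM_of_mem_isoRows (hRe hs)
      exact breakerHolds_of_card_le hr0 (by omega) (by omega)

theorem breakerHolds_start [Nonempty α] (m : α ≃ β) {N : Finset (α × β)}
    (hN : ∀ a, (a, m a) ∈ N) : BreakerHolds (Fintype.card α + 1) N ∅ := by
  refine breakerHolds_of_matching (by simp) (by simp) m (by simp [mem_isoRows, mem_isoCols])
    (Classical.arbitrary α) (by simp [mem_isoRows]) (fun a _ _ => hN a) ?_
  simp [isoRows]

end Breaker

/-! ### Degrees in a bipartite graph and the choice of a non-adjacent pair -/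

section Degrees

variable {α β : Type*} [DecidableEq α] [DecidableEq β]

/-- The number of pairs of `N` in the row `a`. -/
def rowDeg (N : Finset (α × β)) (a : α) : ℕ := #{p ∈ N | p.1 = a}

/-- The number of pairs of `N` in the column `b`. -/
def colDeg (N : Finset (α × β)) (b : β) : ℕ := #{p ∈ N | p.2 = b}

theorem rowDeg_mono {N N' : Finset (α × β)} (h : N ⊆ N') (a : α) : rowDeg N a ≤ rowDeg N' a :=
  card_le_card (filter_subset_filter _ h)

theorem colDeg_mono {N N' : Finset (α × β)} (h : N ⊆ N') (b : β) : colDeg N b ≤ colDeg N' b :=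
  card_le_card (filter_subset_filter _ h)

theorem card_filter_le_succ {γ : Type*} [DecidableEq γ] {N N' : Finset γ} (h : N ⊆ N')
    (hc : #N' ≤ #N + 1) (P : γ → Prop) [DecidablePred P] : #(N'.filter P) ≤ #(N.filter P) + 1 := by
  have h1 : N'.filter P ⊆ N.filter P ∪ (N' \ N) := by
    intro x hx
    rw [mem_filter] at hx
    rw [mem_union, mem_filter, mem_sdiff]
    tauto
  have h2 := (card_le_card h1).trans (card_union_le _ _)
  rw [card_sdiff_of_subset h] at h2
  omega

theorem rowDeg_le_succ {N N' : Finset (α × β)} (h : N ⊆ N') (hc : #N' ≤ #N + 1) (a : α) :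
    rowDeg N' a ≤ rowDeg N a + 1 := card_filter_le_succ h hc _

theorem colDeg_le_succ {N N' : Finset (α × β)} (h : N ⊆ N') (hc : #N' ≤ #N + 1) (b : β) :
    colDeg N' b ≤ colDeg N b + 1 := card_filter_le_succ h hc _

theorem rowDeg_swap (N : Finset (α × β)) (b : β) :
    rowDeg (N.map (Equiv.prodComm α β).toEmbedding) b = colDeg N b := by
  unfold rowDeg colDeg
  rw [filter_map, card_map]
  rfl

theorem colDeg_swap (N : Finset (α × β)) (a : α) :
    colDeg (N.map (Equiv.prodComm α β).toEmbedding) a = rowDeg N a := by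
  unfold rowDeg colDeg
  rw [filter_map, card_map]
  rfl

theorem sum_rowDeg_le (N : Finset (α × β)) (S : Finset α) : ∑ a ∈ S, rowDeg N a ≤ #N := by
  unfold rowDeg
  rw [← card_biUnion]
  · exact card_le_card (biUnion_subset.2 fun a _ => filter_subset _ _)
  · intro a _ b _ hab
    rw [Function.onFun, Finset.disjoint_left]
    intro p hp hp'
    exact hab ((mem_filter.1 hp).2.symm.trans (mem_filter.1 hp').2)

theorem sum_colDeg_le (N : Finset (α × β)) (T : Finset β) : ∑ b ∈ T, colDeg N b ≤ #N := by
  have := sum_rowDeg_le (N.map (Equiv.prodComm α β).toEmbedding) T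
  simpa only [rowDeg_swap, card_map] using this

theorem card_eq_sum_rowDeg {E : Finset (α × β)} {S : Finset α} {T : Finset β}
    (hE : E ⊆ S ×ˢ T) : #E = ∑ a ∈ S, rowDeg E a :=
  card_eq_sum_card_fiberwise fun _ hp => (mem_product.1 (hE hp)).1

theorem card_eq_sum_colDeg {E : Finset (α × β)} {S : Finset α} {T : Finset β}
    (hE : E ⊆ S ×ˢ T) : #E = ∑ b ∈ T, colDeg E b :=
  card_eq_sum_card_fiberwise fun _ hp => (mem_product.1 (hE hp)).2

theorem exists_notMem_of_rowDeg_lt {E : Finset (α × β)} {T : Finset β} {u : α}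
    (h : rowDeg E u < #T) : ∃ x ∈ T, (u, x) ∉ E := by
  by_contra! hc
  refine absurd h (not_lt.2 ?_)
  refine card_le_card_of_injOn (fun x => (u, x)) (fun x hx => ?_) fun x _ y _ hxy => ?_
  · simpa using hc x hx
  · exact congrArg Prod.snd hxy

theorem exists_notMem_of_colDeg_lt {E : Finset (α × β)} {S : Finset α} {x : β}
    (h : colDeg E x < #S) : ∃ u ∈ S, (u, x) ∉ E := by
  by_contra! hc
  refine absurd h (not_lt.2 ?_)
  refine card_le_card_of_injOn (fun u => (u, x)) (fun u hu => ?_) fun u _ v _ huv => ?_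
  · simpa using hc u hu
  · exact congrArg Prod.fst huv

theorem rowDeg_pos {E : Finset (α × β)} {u : α} {x : β} (h : (u, x) ∈ E) : 1 ≤ rowDeg E u :=
  card_pos.2 ⟨(u, x), by simpa using h⟩

theorem colDeg_pos {E : Finset (α × β)} {u : α} {x : β} (h : (u, x) ∈ E) : 1 ≤ colDeg E x :=
  card_pos.2 ⟨(u, x), by simpa using h⟩

theorem two_le_rowDeg {E : Finset (α × β)} {u : α} {x y : β} (hx : (u, x) ∈ E) (hy : (u, y) ∈ E)
    (hxy : x ≠ y) : 2 ≤ rowDeg E u :=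
  one_lt_card.2 ⟨(u, x), by simpa using hx, (u, y), by simpa using hy, by simpa using hxy⟩

theorem two_le_colDeg {E : Finset (α × β)} {u v : α} {x : β} (hu : (u, x) ∈ E) (hv : (v, x) ∈ E)
    (huv : u ≠ v) : 2 ≤ colDeg E x :=
  one_lt_card.2 ⟨(u, x), by simpa using hu, (v, x), by simpa using hv, by simpa using huv⟩

/-- The pairs of `N` with both coordinates in the given sets. -/
def restr (N : Finset (α × β)) (S : Finset α) (T : Finset β) : Finset (α × β) :=
  {p ∈ N | p.1 ∈ S ∧ p.2 ∈ T}

theorem mem_restr {N : Finset (α × β)} {S : Finset α} {T : Finset β} {p : α × β} :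
    p ∈ restr N S T ↔ p ∈ N ∧ p.1 ∈ S ∧ p.2 ∈ T := mem_filter

theorem restr_subset_product (N : Finset (α × β)) (S : Finset α) (T : Finset β) :
    restr N S T ⊆ S ×ˢ T := fun _ hp => mem_product.2 (mem_restr.1 hp).2

theorem restr_subset (N : Finset (α × β)) (S : Finset α) (T : Finset β) : restr N S T ⊆ N :=
  filter_subset _ _

theorem card_restr_erase {N : Finset (α × β)} {S : Finset α} {T : Finset β} {u : α} {x : β}
    (h : (u, x) ∉ restr N S T) :
    #(restr N (S.erase u) (T.erase x)) + rowDeg (restr N S T) u + colDeg (restr N S T) x =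
      #(restr N S T) := by
  unfold rowDeg colDeg
  rw [← card_union_of_disjoint, ← card_union_of_disjoint]
  · congr 1
    ext p
    simp only [mem_union, mem_filter, mem_restr, mem_erase]
    tauto
  · rw [Finset.disjoint_left]
    intro p hp hp'
    simp only [mem_union, mem_filter, mem_restr, mem_erase] at hp hp'
    rcases hp with hp | hp
    · exact hp.2.2.1 hp'.2
    · refine h (mem_restr.2 ?_)
      have : p = (u, x) := Prod.ext hp.2 hp'.2
      rw [← this]
      exact hp.1
  · rw [Finset.disjoint_left]
    intro p hp hp'
    simp only [mem_filter, mem_restr, mem_erase] at hp hp'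
    exact hp.2.1.1 hp'.2

end Degrees

section Selection

variable {α β : Type*} [DecidableEq α] [DecidableEq β]

/-- In a bipartite graph `E` without full rows or columns, with more edges than an average degree of
`max a b` accounts for, some non-adjacent row and column have degrees summing to more than
`a + b + 1`: either a single vertex does it, or all degrees are small, and then the many
columns of degree above `b` are not all adjacent to a row of degree above `a`. -/
theorem exists_notMem_of_card_lt {E : Finset (α × β)} {S : Finset α} {T : Finset β} {k a b : ℕ}
    (hE : E ⊆ S ×ˢ T) (hS : #S = k) (hT : #T = k) (hrow : ∀ u ∈ S, rowDeg E u < k)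
    (hcol : ∀ x ∈ T, colDeg E x < k) (ha : a * k < #E) (hb : b * k + (a + 1) * (a + b + 1) < #E) :
    ∃ u ∈ S, ∃ x ∈ T, (u, x) ∉ E ∧ a + b + 2 ≤ rowDeg E u + colDeg E x := by
  by_cases h1 : ∃ u ∈ S, a + b + 2 ≤ rowDeg E u
  · obtain ⟨u, hu, h1⟩ := h1
    obtain ⟨x, hx, h2⟩ := exists_notMem_of_rowDeg_lt (T := T) (by rw [hT]; exact hrow u hu)
    exact ⟨u, hu, x, hx, h2, by omega⟩
  by_cases h2 : ∃ x ∈ T, a + b + 2 ≤ colDeg E x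
  · obtain ⟨x, hx, h2⟩ := h2
    obtain ⟨u, hu, h3⟩ := exists_notMem_of_colDeg_lt (S := S) (by rw [hS]; exact hcol x hx)
    exact ⟨u, hu, x, hx, h3, by omega⟩
  push Not at h1 h2
  obtain ⟨u, hu, hua⟩ : ∃ u ∈ S, a + 1 ≤ rowDeg E u := by
    by_contra! hc
    have : #E ≤ ∑ _u ∈ S, a := by
      rw [card_eq_sum_rowDeg hE]
      exact sum_le_sum fun u hu => Nat.lt_succ_iff.1 (hc u hu)
    rw [sum_const, hS, smul_eq_mul, mul_comm] at this
    omega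
  set T' := T.filter fun x => b + 1 ≤ colDeg E x with hT'
  have hcard : #E ≤ b * k + (a + 1) * #T' := by
    have : #E ≤ ∑ x ∈ T, (b + if b + 1 ≤ colDeg E x then a + 1 else 0) := by
      rw [card_eq_sum_colDeg hE]
      refine sum_le_sum fun x hx => ?_
      have := h2 x hx
      split_ifs <;> omega
    rw [sum_add_distrib, sum_const, hT, smul_eq_mul, ← sum_filter, sum_const, smul_eq_mul] at this
    rw [hT']
    linarith [mul_comm k b, mul_comm (a + 1) #(T.filter fun x => b + 1 ≤ colDeg E x)]
  have hT'card : a + b + 1 < #T' :=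
    lt_of_mul_lt_mul_left (by omega : (a + 1) * (a + b + 1) < (a + 1) * #T') (Nat.zero_le _)
  obtain ⟨x, hx, hux⟩ := exists_notMem_of_rowDeg_lt (E := E) (T := T') (u := u)
    (by have := h1 u hu; omega)
  rw [hT', mem_filter] at hx
  exact ⟨u, hu, x, hx.1, hux, by omega⟩

/-- The case of `exists_notMem_of_card_le` in which a row `u` is full: at most one edge avoids `u`,
and every column has positive degree. -/
theorem exists_notMem_of_full_row {E : Finset (α × β)} {S : Finset α} {T : Finset β} {k : ℕ}
    (hE : E ⊆ S ×ˢ T) (hS : #S = k) (hT : #T = k) (hk : 2 ≤ k) (hc : #E ≤ k + 1) {u : α}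
    (hfull : k ≤ rowDeg E u) :
    ∃ u ∈ S, ∃ x ∈ T, (u, x) ∉ E ∧ #E + 1 ≤ k + rowDeg E u + colDeg E x := by
  have hsub : {p ∈ E | p.1 = u} ⊆ T.image fun x => (u, x) := by
    intro p hp
    rw [mem_filter] at hp
    exact mem_image.2 ⟨p.2, (mem_product.1 (hE hp.1)).2, by rw [← hp.2]⟩
  have heq : {p ∈ E | p.1 = u} = T.image fun x => (u, x) :=
    eq_of_subset_of_card_le hsub (card_image_le.trans (hT.le.trans hfull))
  have hall : ∀ x ∈ T, (u, x) ∈ E := by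
    intro x hx
    have : (u, x) ∈ T.image fun x => (u, x) := mem_image_of_mem _ hx
    rw [← heq] at this
    exact (mem_filter.1 this).1
  have hsplit : rowDeg E u + #{p ∈ E | ¬ p.1 = u} = #E :=
    card_filter_add_card_filter_not _
  have hle : #{p ∈ E | ¬ p.1 = u} ≤ 1 := by omega
  by_cases hex : ∃ p ∈ E, p.1 ≠ u
  · obtain ⟨⟨v, y⟩, hp, hv⟩ := hex
    obtain ⟨x, hx, hxy⟩ := exists_mem_ne (by omega : 1 < #T) y
    refine ⟨v, (mem_product.1 (hE hp)).1, x, hx, fun hvx => hxy ?_, ?_⟩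
    · have := card_le_one.1 hle (v, x) (mem_filter.2 ⟨hvx, hv⟩) (v, y) (mem_filter.2 ⟨hp, hv⟩)
      exact congrArg Prod.snd this
    · have h1 := rowDeg_pos hp
      have h2 := colDeg_pos (hall x hx)
      omega
  · push Not at hex
    obtain ⟨v, hv, hvu⟩ := exists_mem_ne (by omega : 1 < #S) u
    obtain ⟨x, hx⟩ := card_pos.1 (by omega : 0 < #T)
    refine ⟨v, hv, x, hx, fun h => hvu (hex _ h), ?_⟩
    have h2 := colDeg_pos (hall x hx)
    have h3 : #E ≤ k := by
      have : #{p ∈ E | ¬ p.1 = u} = 0 := by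
        rw [card_eq_zero, filter_eq_empty_iff]
        exact fun p hp h => h (hex p hp)
      have h4 : rowDeg E u ≤ #T := (card_le_card hsub).trans card_image_le
      omega
    omega

/-- In a bipartite graph `E` with at most `k + 1` edges on `k + k` vertices, deleting a suitable
non-adjacent row and column leaves at most `k - 1` edges. -/
theorem exists_notMem_of_card_le {E : Finset (α × β)} {S : Finset α} {T : Finset β} {k : ℕ}
    (hE : E ⊆ S ×ˢ T) (hS : #S = k) (hT : #T = k) (hk : 2 ≤ k) (hc : #E ≤ k + 1) :
    ∃ u ∈ S, ∃ x ∈ T, (u, x) ∉ E ∧ #E + 1 ≤ k + rowDeg E u + colDeg E x := by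
  by_cases hsmall : #E + 1 ≤ k
  · obtain ⟨⟨u, x⟩, hp, hpE⟩ : ∃ p ∈ S ×ˢ T, p ∉ E := by
      refine exists_mem_notMem_of_card_lt_card ?_
      rw [card_product, hS, hT]
      nlinarith
    rw [mem_product] at hp
    exact ⟨u, hp.1, x, hp.2, hpE, by omega⟩
  by_cases h1 : ∃ u ∈ S, 2 ≤ rowDeg E u
  · obtain ⟨u, hu, h1⟩ := h1
    by_cases hf : k ≤ rowDeg E u
    · exact exists_notMem_of_full_row hE hS hT hk hc hf
    · obtain ⟨x, hx, hux⟩ := exists_notMem_of_rowDeg_lt (E := E) (T := T) (u := u) (by omega)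
      exact ⟨u, hu, x, hx, hux, by omega⟩
  by_cases h2 : ∃ x ∈ T, 2 ≤ colDeg E x
  · obtain ⟨x, hx, h2⟩ := h2
    by_cases hf : k ≤ colDeg E x
    · obtain ⟨y, hy, v, hv, h3, h4⟩ := exists_notMem_of_full_row (S := T) (T := S) (k := k) (u := x)
        (E := E.map (Equiv.prodComm α β).toEmbedding) (by
          intro p hp
          rw [mem_map_equiv] at hp
          have := mem_product.1 (hE hp)
          exact mem_product.2 ⟨this.2, this.1⟩) hT hS hk (by rwa [card_map])
        (by rwa [rowDeg_swap])
      rw [rowDeg_swap, colDeg_swap, card_map] at h4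
      refine ⟨v, hv, y, hy, fun h => h3 ?_, by omega⟩
      rw [mem_map_equiv]
      exact h
    · obtain ⟨u, hu, hux⟩ := exists_notMem_of_colDeg_lt (E := E) (S := S) (x := x) (by omega)
      exact ⟨u, hu, x, hx, hux, by omega⟩
  push Not at h1 h2
  obtain ⟨⟨u, y⟩, hp, ⟨v, x⟩, hq, hpq⟩ := one_lt_card.1 (by omega : 1 < #E)
  have hu := (mem_product.1 (hE hp)).1
  have hx := (mem_product.1 (hE hq)).2
  have hux : (u, x) ∉ E := by
    intro h
    by_cases hxy : x = y
    · subst hxy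
      have hne : u ≠ v := fun h' => hpq (by rw [h'])
      have := two_le_colDeg hp hq hne
      have := h2 x hx
      omega
    · have := two_le_rowDeg h hp hxy
      have := h1 u hu
      omega
  have := rowDeg_pos hp
  have := colDeg_pos hq
  exact ⟨u, hu, x, hx, hux, by omega⟩

end Selection

/-! ### Maker's endgame -/

section Maker

variable {α β : Type*} [DecidableEq α] [DecidableEq β]

/-- `M` is a perfect matching between the rows outside `S` and the columns outside `T`. It is
presented by a bijection `f` that also pairs up `S` and `T` in some way. -/
def Matched (S : Finset α) (T : Finset β) (M : Finset (α × β)) : Prop :=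
  ∃ f : α ≃ β, (∀ a, a ∈ S ↔ f a ∈ T) ∧ ∀ p : α × β, p ∈ M ↔ p.1 ∉ S ∧ f p.1 = p.2

theorem Matched.insert {S : Finset α} {T : Finset β} {M : Finset (α × β)} (h : Matched S T M)
    {u : α} {x : β} (hu : u ∈ S) (hx : x ∈ T) :
    Matched (S.erase u) (T.erase x) (insert (u, x) M) := by
  obtain ⟨f, hST, hM⟩ := h
  set v := f.symm x with hv
  have hfv : f v = x := by simp [hv]
  have hvS : v ∈ S := (hST v).2 (hfv ▸ hx)
  refine ⟨(Equiv.swap u v).trans f, fun a => ?_, ?_⟩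
  · rw [Equiv.trans_apply, mem_erase, mem_erase]
    by_cases hau : a = u
    · simp [hau, hfv]
    by_cases hav : a = v
    · subst hav
      rw [Equiv.swap_apply_right, ← hfv, f.injective.ne_iff, ← hST]
      exact ⟨fun h => ⟨fun h' => h.1 h'.symm, hu⟩, fun h => ⟨fun h' => h.1 h'.symm, hvS⟩⟩
    · rw [Equiv.swap_apply_of_ne_of_ne hau hav, ← hfv, f.injective.ne_iff, ← hST]
      tauto
  · rintro ⟨a, b⟩
    rw [mem_insert, hM, mem_erase, Equiv.trans_apply, Prod.mk.injEq]
    dsimp only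
    by_cases hau : a = u
    · subst hau
      simp [hfv, hu, eq_comm]
    by_cases hav : a = v
    · subst hav
      simp [hau, hvS]
    · rw [Equiv.swap_apply_of_ne_of_ne hau hav]
      tauto

theorem makerWins_succ_of_matched {S : Finset α} {T : Finset β} {N M : Finset (α × β)} {r : ℕ}
    (hM : Matched S T M)
    (h : ∀ N', N ⊆ N' → #N' ≤ #N + 1 → ∃ u ∈ S, ∃ x ∈ T, (u, x) ∉ N' ∧
      ∀ M', Matched (S.erase u) (T.erase x) M' → MakerWins r N' M') :
    MakerWins (r + 1) N M := by
  refine Or.inr fun N' h1 h2 _ => ?_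
  obtain ⟨u, hu, x, hx, hN, hwin⟩ := h N' h1 h2
  refine ⟨(u, x), hN, fun hc => ?_, hwin _ (hM.insert hu hx)⟩
  obtain ⟨f, -, hM'⟩ := hM
  exact ((hM' _).1 hc).1 hu

theorem hasPM_of_swap {f : α ≃ β} {u : α} {P : Finset (α × β)} {a : α} (hau : a ≠ u)
    (h1 : (u, f a) ∈ P) (h2 : (a, f u) ∈ P) (h : ∀ c, c ≠ u → c ≠ a → (c, f c) ∈ P) :
    HasPM P := by
  refine ⟨(Equiv.swap u a).trans f, fun c => ?_⟩
  rw [Equiv.trans_apply]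
  by_cases hcu : c = u
  · subst hcu; rwa [Equiv.swap_apply_left]
  by_cases hca : c = a
  · subst hca; rwa [Equiv.swap_apply_right]
  · rw [Equiv.swap_apply_of_ne_of_ne hcu hca]; exact h c hcu hca

theorem hasPM_of_cycle {f : α ≃ β} {u : α} {P : Finset (α × β)} {a b : α} (hau : a ≠ u)
    (hbu : b ≠ u) (hba : b ≠ a) (h1 : (u, f a) ∈ P) (h2 : (a, f b) ∈ P) (h3 : (b, f u) ∈ P)
    (h : ∀ c, c ≠ u → c ≠ a → c ≠ b → (c, f c) ∈ P) : HasPM P := by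
  refine ⟨((Equiv.swap a b).trans (Equiv.swap u a)).trans f, fun c => ?_⟩
  rw [Equiv.trans_apply, Equiv.trans_apply]
  by_cases hcu : c = u
  · subst hcu
    rw [Equiv.swap_apply_of_ne_of_ne hau.symm hbu.symm, Equiv.swap_apply_left]; exact h1
  by_cases hca : c = a
  · subst hca
    rw [Equiv.swap_apply_left, Equiv.swap_apply_of_ne_of_ne hbu hba]; exact h2
  by_cases hcb : c = b
  · subst hcb
    rw [Equiv.swap_apply_right, Equiv.swap_apply_right]; exact h3
  · rw [Equiv.swap_apply_of_ne_of_ne hca hcb, Equiv.swap_apply_of_ne_of_ne hcu hca]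
    exact h c hcu hca hcb

variable [Fintype α] [Fintype β]

theorem card_filter_row (f : α ≃ β) (N : Finset (α × β)) (u : α) :
    #(univ.filter fun a => (u, f a) ∈ N) ≤ rowDeg N u := by
  refine card_le_card_of_injOn (fun a => (u, f a)) (fun a ha => ?_) fun a _ b _ hab => ?_
  · simpa using ha
  · exact f.injective (congrArg Prod.snd hab)

theorem card_filter_col (N : Finset (α × β)) (x : β) :
    #(univ.filter fun a => (a, x) ∈ N) ≤ colDeg N x := by
  refine card_le_card_of_injOn (fun a => (a, x)) (fun a ha => ?_) fun a _ b _ hab => ?_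
  · simpa using ha
  · exact congrArg Prod.fst hab

/-- With one row `u` and one column `x` left unmatched, both of small blocked degree, Maker needs
three more moves. She first claims `(u, f a)`, which threatens to complete a perfect matching with
`(a, f u)`. Breaker has to claim that pair, and then `(b, f u)` creates the double threat
`(u, f b)`, `(a, f b)`. -/
theorem makerWins_three {N M : Finset (α × β)} {u : α} {x : β} {C : ℕ} (hM : Matched {u} {x} M)
    (hN : #N ≤ C * Fintype.card α) (hu : 8 * rowDeg N u ≤ Fintype.card α)
    (hx : 8 * colDeg N x ≤ Fintype.card α) (hC : 16 * C + 16 ≤ Fintype.card α) :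
    MakerWins 3 N M := by
  obtain ⟨f, hST, hM⟩ := hM
  set n := Fintype.card α with hn
  have hfu : f u = x := by simpa using (hST u).1 (by simp)
  subst hfu
  have hMmem : ∀ c, c ≠ u → (c, f c) ∈ M := fun c hc => (hM _).2 ⟨by simpa using hc, rfl⟩
  refine Or.inr fun N₁ hN₁ hc₁ _ => ?_
  -- The blocked degree of the row `a` is kept small for the sake of the double threat.
  obtain ⟨a, ha⟩ : ∃ a, a ∉ ({u} ∪ univ.filter fun a => (u, f a) ∈ N₁) ∪
      ((univ.filter fun a => (a, f u) ∈ N₁) ∪ univ.filter fun a => n < 4 * rowDeg N₁ a) := by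
    by_contra! hc
    have huniv := eq_univ_of_forall hc
    have hcard := congrArg card huniv
    rw [card_univ] at hcard
    have h1 := card_union_le ({u} ∪ univ.filter fun a => (u, f a) ∈ N₁)
      ((univ.filter fun a => (a, f u) ∈ N₁) ∪ univ.filter fun a => n < 4 * rowDeg N₁ a)
    have h2 := card_union_le {u} (univ.filter fun a => (u, f a) ∈ N₁)
    have h3 := card_union_le (univ.filter fun a => (a, f u) ∈ N₁)
      (univ.filter fun a => n < 4 * rowDeg N₁ a)
    have h4 := card_filter_row f N₁ u
    have h5 := card_filter_col N₁ (f u)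
    have h6 := rowDeg_le_succ hN₁ hc₁ u
    have h7 := colDeg_le_succ hN₁ hc₁ (f u)
    have h8 : #(univ.filter fun a => n < 4 * rowDeg N₁ a) * n ≤ 4 * #N₁ := by
      refine le_trans ?_ (Nat.mul_le_mul_left 4
        (sum_rowDeg_le N₁ (univ.filter fun a => n < 4 * rowDeg N₁ a)))
      rw [mul_sum, ← smul_eq_mul, ← sum_const]
      exact sum_le_sum fun a ha => (mem_filter.1 ha).2.le
    have h9 : #(univ.filter fun a => n < 4 * rowDeg N₁ a) < 4 * C + 1 := by
      refine lt_of_mul_lt_mul_right (a := n) ?_ (Nat.zero_le _)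
      nlinarith
    rw [card_singleton] at h2
    omega
  simp only [mem_union, mem_singleton, mem_filter, mem_univ, true_and, not_or, not_lt] at ha
  obtain ⟨⟨hau, hua⟩, hax, hdeg⟩ := ha
  refine ⟨(u, f a), hua, fun h => by simpa using ((hM _).1 h).1,
    Or.inr fun N₂ hN₂ hc₂ hd₂ => ?_⟩
  by_cases hax₂ : (a, f u) ∈ N₂
  swap
  · refine ⟨(a, f u), hax₂, fun h => ?_, Or.inl ?_⟩
    · rcases mem_insert.1 h with h | h
      · exact hau (congrArg Prod.fst h)
      · exact hau (f.injective ((hM _).1 h).2)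
    · refine hasPM_of_swap (f := f) hau (by simp) (by simp) fun c hcu hca => ?_
      exact mem_insert_of_mem (mem_insert_of_mem (hMmem c hcu))
  obtain ⟨b, hb⟩ : ∃ b, b ∉ ({u, a} ∪ univ.filter fun b => (u, f b) ∈ N₂) ∪
      ((univ.filter fun b => (b, f u) ∈ N₂) ∪ univ.filter fun b => (a, f b) ∈ N₂) := by
    by_contra! hc
    have huniv := eq_univ_of_forall hc
    have hcard := congrArg card huniv
    rw [card_univ] at hcard
    have h1 := card_union_le ({u, a} ∪ univ.filter fun b => (u, f b) ∈ N₂)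
      ((univ.filter fun b => (b, f u) ∈ N₂) ∪ univ.filter fun b => (a, f b) ∈ N₂)
    have h2 := card_union_le {u, a} (univ.filter fun b => (u, f b) ∈ N₂)
    have h3 := card_union_le (univ.filter fun b => (b, f u) ∈ N₂)
      (univ.filter fun b => (a, f b) ∈ N₂)
    have h4 := card_filter_row f N₂ u
    have h5 := card_filter_col N₂ (f u)
    have h6 := card_filter_row f N₂ a
    have h7 := rowDeg_le_succ hN₁ hc₁ u
    have h8 := colDeg_le_succ hN₁ hc₁ (f u)
    have h9 := rowDeg_le_succ hN₂ hc₂ u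
    have h10 := colDeg_le_succ hN₂ hc₂ (f u)
    have h11 := rowDeg_le_succ hN₂ hc₂ a
    have h12 : #{u, a} ≤ 2 := card_le_two
    omega
  simp only [mem_union, mem_singleton, mem_insert, mem_filter, mem_univ, true_and, not_or] at hb
  obtain ⟨⟨⟨hbu, hba⟩, hub⟩, hbx, hab⟩ := hb
  refine ⟨(b, f u), hbx, fun h => ?_, Or.inr fun N₃ hN₃ hc₃ _ => ?_⟩
  · rcases mem_insert.1 h with h | h
    · exact hbu (congrArg Prod.fst h)
    · exact hbu (f.injective ((hM _).1 h).2)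
  have hbM : ∀ c, c ≠ b → (c, f b) ∉ insert (b, f u) (insert (u, f a) M) := by
    intro c hc h
    rcases mem_insert.1 h with h | h
    · exact hc (congrArg Prod.fst h)
    rcases mem_insert.1 h with h | h
    · exact hba (f.injective (congrArg Prod.snd h))
    · exact hc (f.injective ((hM _).1 h).2)
  -- `(u, f b)` closes the path `u, f b, b, x`, and `(a, f b)` the path through both `a` and `b`.
  by_cases hub₃ : (u, f b) ∈ N₃
  · have hab₃ : (a, f b) ∉ N₃ := by
      intro hab₃
      have h1 : insert (u, f b) (insert (a, f b) N₂) ⊆ N₃ :=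
        insert_subset hub₃ (insert_subset hab₃ hN₃)
      have h2 := card_le_card h1
      rw [card_insert_of_notMem, card_insert_of_notMem hab] at h2
      · omega
      · rw [mem_insert, not_or]
        exact ⟨fun h => hau (congrArg Prod.fst h).symm, hub⟩
    refine ⟨(a, f b), hab₃, hbM a (Ne.symm hba), ?_⟩
    refine hasPM_of_cycle (f := f) hau hbu hba (by simp) (by simp) (by simp) fun c hcu _ _ => ?_
    exact mem_insert_of_mem (mem_insert_of_mem (mem_insert_of_mem (hMmem c hcu)))
  · refine ⟨(u, f b), hub₃, hbM u (Ne.symm hbu), ?_⟩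
    refine hasPM_of_swap (f := f) hbu (by simp) (by simp) fun c hcu _ => ?_
    exact mem_insert_of_mem (mem_insert_of_mem (mem_insert_of_mem (hMmem c hcu)))

theorem card_restr_le_succ {N N' : Finset (α × β)} (h : N ⊆ N') (hc : #N' ≤ #N + 1)
    (S : Finset α) (T : Finset β) : #(restr N' S T) ≤ #(restr N S T) + 1 :=
  card_filter_le_succ h hc _

/-- If at most `k` pairs are blocked among the `k` unmatched rows and columns, Maker keeps it that
way until a single row and a single column remain. -/
theorem makerWins_of_card_restr_le {k : ℕ} (hk : 1 ≤ k) {S : Finset α} {T : Finset β}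
    {N M : Finset (α × β)} {C : ℕ} (hM : Matched S T M) (hS : #S = k) (hT : #T = k)
    (he : #(restr N S T) ≤ k) (hrow : ∀ u ∈ S, 8 * (rowDeg N u + k) ≤ Fintype.card α)
    (hcol : ∀ x ∈ T, 8 * (colDeg N x + k) ≤ Fintype.card α)
    (hN : #N + k ≤ C * Fintype.card α) (hC : 16 * C + 16 ≤ Fintype.card α) :
    MakerWins (k + 2) N M := by
  induction k, hk using Nat.le_induction generalizing S T N M with
  | base =>
    obtain ⟨u, rfl⟩ := card_eq_one.1 hS
    obtain ⟨x, rfl⟩ := card_eq_one.1 hT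
    have h1 := hrow u (by simp)
    have h2 := hcol x (by simp)
    exact makerWins_three hM (by omega) (by omega) (by omega) hC
  | succ k hk ih =>
    refine makerWins_succ_of_matched hM fun N' hN' hc' => ?_
    have he' := card_restr_le_succ hN' hc' S T
    obtain ⟨u, hu, x, hx, hux, hd⟩ := exists_notMem_of_card_le (restr_subset_product N' S T)
      hS hT (by omega) (by omega)
    refine ⟨u, hu, x, hx, fun h => hux (mem_restr.2 ⟨h, hu, hx⟩), fun M' hM' => ?_⟩
    have h1 := card_restr_erase hux
    refine ih hM' (by rw [card_erase_of_mem hu]; omega) (by rw [card_erase_of_mem hx]; omega)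
      (by omega) (fun v hv => ?_) (fun y hy => ?_) (by omega)
    · have h2 := hrow v (mem_of_mem_erase hv)
      have h3 := rowDeg_le_succ hN' hc' v
      omega
    · have h2 := hcol y (mem_of_mem_erase hy)
      have h3 := colDeg_le_succ hN' hc' y
      omega

/-- If `k + A` pairs are blocked among the `k` unmatched rows and columns, Maker decreases the
excess `A` in each move. -/
theorem makerWins_of_card_restr_le_add {k A : ℕ} {S : Finset α} {T : Finset β}
    {N M : Finset (α × β)} {C : ℕ} (hk : 1 ≤ k) (hM : Matched S T M) (hS : #S = k) (hT : #T = k)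
    (he : #(restr N S T) ≤ k + A) (hrow : ∀ u ∈ S, 8 * (rowDeg N u + k) ≤ Fintype.card α)
    (hcol : ∀ x ∈ T, 8 * (colDeg N x + k) ≤ Fintype.card α)
    (hrow' : ∀ u ∈ S, rowDeg N u + 2 * A < k) (hcol' : ∀ x ∈ T, colDeg N x + 2 * A < k)
    (hN : #N + k ≤ C * Fintype.card α) (hC : 16 * C + 16 ≤ Fintype.card α) :
    MakerWins (k + 2) N M := by
  induction A generalizing k S T N M with
  | zero => exact makerWins_of_card_restr_le hk hM hS hT he hrow hcol hN hC
  | succ A ih =>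
    have hk3 : 3 ≤ k := by
      obtain ⟨u, hu⟩ := card_pos.1 (by omega : 0 < #S)
      have := hrow' u hu
      omega
    obtain ⟨j, rfl⟩ : ∃ j, k = j + 1 := ⟨k - 1, by omega⟩
    refine makerWins_succ_of_matched hM fun N' hN' hc' => ?_
    have he' := card_restr_le_succ hN' hc' S T
    have hsel : ∃ u ∈ S, ∃ x ∈ T, (u, x) ∉ restr N' S T ∧
        #(restr N' S T) ≤ j + A + rowDeg (restr N' S T) u + colDeg (restr N' S T) x := by
      by_cases hle : #(restr N' S T) ≤ j + 1 + 1
      · obtain ⟨u, hu, x, hx, hux, hd⟩ := exists_notMem_of_card_le (restr_subset_product N' S T)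
          hS hT (by omega) (by omega)
        exact ⟨u, hu, x, hx, hux, by omega⟩
      · have hr : ∀ u ∈ S, rowDeg (restr N' S T) u < j + 1 := by
          intro u hu
          have h1 := hrow' u hu
          have h2 := rowDeg_le_succ hN' hc' u
          have h3 := rowDeg_mono (restr_subset N' S T) u
          omega
        have hc : ∀ x ∈ T, colDeg (restr N' S T) x < j + 1 := by
          intro x hx
          have h1 := hcol' x hx
          have h2 := colDeg_le_succ hN' hc' x
          have h3 := colDeg_mono (restr_subset N' S T) x
          omega
        obtain ⟨u, hu, x, hx, hux, hd⟩ := exists_notMem_of_card_lt (a := 1) (b := 0)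
          (restr_subset_product N' S T) hS hT hr hc (by omega) (by omega)
        exact ⟨u, hu, x, hx, hux, by omega⟩
    obtain ⟨u, hu, x, hx, hux, hd⟩ := hsel
    refine ⟨u, hu, x, hx, fun h => hux (mem_restr.2 ⟨h, hu, hx⟩), fun M' hM' => ?_⟩
    have h1 := card_restr_erase hux
    refine ih (by omega) hM' (by rw [card_erase_of_mem hu]; omega)
      (by rw [card_erase_of_mem hx]; omega) (by omega) (fun v hv => ?_) (fun y hy => ?_)
      (fun v hv => ?_) (fun y hy => ?_) (by omega)
    · have h2 := hrow v (mem_of_mem_erase hv)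
      have h3 := rowDeg_le_succ hN' hc' v
      omega
    · have h2 := hcol y (mem_of_mem_erase hy)
      have h3 := colDeg_le_succ hN' hc' y
      omega
    · have h2 := hrow' v (mem_of_mem_erase hv)
      have h3 := rowDeg_le_succ hN' hc' v
      omega
    · have h2 := hcol' y (mem_of_mem_erase hy)
      have h3 := colDeg_le_succ hN' hc' y
      omega

end Maker

/-! ### Maker's play while many vertices are unmatched -/

section Maker

variable {α β : Type*} [DecidableEq α] [DecidableEq β]

/-- Averaging form of the selection lemma: up to an error depending only on `d`, Maker can delete
a non-adjacent row and column whose degrees sum to twice the average degree. -/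
theorem exists_notMem_of_average {E : Finset (α × β)} {S : Finset α} {T : Finset β} {k d : ℕ}
    (hE : E ⊆ S ×ˢ T) (hS : #S = k) (hT : #T = k) (hk : 1 ≤ k) (hrow : ∀ u ∈ S, rowDeg E u < k)
    (hcol : ∀ x ∈ T, colDeg E x < k) (hd : #E ≤ (d + 2) * (2 * d + 3) + (d + 2) * k) :
    ∃ u ∈ S, ∃ x ∈ T, (u, x) ∉ E ∧
      2 * #E ≤ 2 * ((d + 2) * (2 * d + 3)) + k * (rowDeg E u + colDeg E x) := by
  set K := (d + 2) * (2 * d + 3) with hK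
  by_cases hle : #E ≤ K
  · obtain ⟨u, hu⟩ := card_pos.1 (by omega : 0 < #S)
    obtain ⟨x, hx, hux⟩ := exists_notMem_of_rowDeg_lt (T := T) (by rw [hT]; exact hrow u hu)
    exact ⟨u, hu, x, hx, hux, le_trans (by omega) (Nat.le_add_right _ _)⟩
  -- `c + 1` is the average degree rounded up, after discarding `K` edges
  set c := (#E - K - 1) / k with hc
  have h1 : c * k ≤ #E - K - 1 := Nat.div_mul_le_self _ _
  have h2 : #E - K - 1 < (c + 1) * k := by
    rw [mul_comm]; exact Nat.lt_mul_div_succ _ hk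
  have hcd : c < d + 2 := lt_of_mul_lt_mul_right (by omega : c * k < (d + 2) * k) (Nat.zero_le _)
  have hcK : (c + 1) * (c + c + 1) ≤ K := Nat.mul_le_mul (by omega) (by omega)
  obtain ⟨u, hu, x, hx, hux, hs⟩ := exists_notMem_of_card_lt (a := c) (b := c) hE hS hT hrow hcol
    (by omega) (by omega)
  refine ⟨u, hu, x, hx, hux, ?_⟩
  have h3 := Nat.mul_le_mul_left k hs
  have h4 : k * (c + c + 2) = 2 * ((c + 1) * k) := by ring
  omega

variable [Fintype α] [Fintype β]

/-- The number of matched rows and columns of blocked degree at least `θ`. -/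
def heavyCount (θ : ℕ) (N : Finset (α × β)) (S : Finset α) (T : Finset β) : ℕ :=
  #{a | a ∉ S ∧ θ ≤ rowDeg N a} + #{b | b ∉ T ∧ θ ≤ colDeg N b}

theorem heavyRows_subset {θ : ℕ} {N N' : Finset (α × β)} (h : N ⊆ N') {S S' : Finset α}
    (hS : S' ⊆ S) : (univ.filter fun a => a ∉ S ∧ θ ≤ rowDeg N a) ⊆
      univ.filter fun a => a ∉ S' ∧ θ ≤ rowDeg N' a := by
  intro a ha
  rw [mem_filter] at ha ⊢
  exact ⟨ha.1, fun h' => ha.2.1 (hS h'), ha.2.2.trans (rowDeg_mono h a)⟩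

theorem heavyCols_subset {θ : ℕ} {N N' : Finset (α × β)} (h : N ⊆ N') {T T' : Finset β}
    (hT : T' ⊆ T) : (univ.filter fun b => b ∉ T ∧ θ ≤ colDeg N b) ⊆
      univ.filter fun b => b ∉ T' ∧ θ ≤ colDeg N' b := by
  intro a ha
  rw [mem_filter] at ha ⊢
  exact ⟨ha.1, fun h' => ha.2.1 (hT h'), ha.2.2.trans (colDeg_mono h a)⟩

theorem heavyCount_mono {θ : ℕ} {N N' : Finset (α × β)} (h : N ⊆ N') {S S' : Finset α}
    (hS : S' ⊆ S) {T T' : Finset β} (hT : T' ⊆ T) :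
    heavyCount θ N S T ≤ heavyCount θ N' S' T' :=
  Nat.add_le_add (card_le_card (heavyRows_subset h hS)) (card_le_card (heavyCols_subset h hT))

theorem heavyCount_lt_of_row {θ : ℕ} {N N' : Finset (α × β)} (h : N ⊆ N') {S : Finset α} {u : α}
    (hu : u ∈ S) (hθ : θ ≤ rowDeg N' u) {T T' : Finset β} (hT : T' ⊆ T) :
    heavyCount θ N S T < heavyCount θ N' (S.erase u) T' := by
  refine Nat.add_lt_add_of_lt_of_le (card_lt_card ?_) (card_le_card (heavyCols_subset h hT))
  refine (ssubset_iff_of_subset (heavyRows_subset h (erase_subset u S))).2 ⟨u, ?_, ?_⟩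
  · simp [hθ]
  · simp [hu]

theorem heavyCount_lt_of_col {θ : ℕ} {N N' : Finset (α × β)} (h : N ⊆ N') {S S' : Finset α}
    (hS : S' ⊆ S) {T : Finset β} {x : β} (hx : x ∈ T) (hθ : θ ≤ colDeg N' x) :
    heavyCount θ N S T < heavyCount θ N' S' (T.erase x) := by
  refine Nat.add_lt_add_of_le_of_lt (card_le_card (heavyRows_subset h hS)) (card_lt_card ?_)
  refine (ssubset_iff_of_subset (heavyCols_subset h (erase_subset x T))).2 ⟨x, ?_, ?_⟩
  · simp [hθ]
  · simp [hx]

theorem heavyCount_mul_le (θ : ℕ) (N : Finset (α × β)) (S : Finset α) (T : Finset β) :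
    heavyCount θ N S T * θ ≤ 2 * #N := by
  have h1 : #(univ.filter fun a => a ∉ S ∧ θ ≤ rowDeg N a) * θ ≤ #N := by
    refine le_trans ?_ (sum_rowDeg_le N (univ.filter fun a => a ∉ S ∧ θ ≤ rowDeg N a))
    rw [← smul_eq_mul, ← sum_const]
    exact sum_le_sum fun a ha => (mem_filter.1 ha).2.2
  have h2 : #(univ.filter fun b => b ∉ T ∧ θ ≤ colDeg N b) * θ ≤ #N := by
    refine le_trans ?_ (sum_colDeg_le N (univ.filter fun b => b ∉ T ∧ θ ≤ colDeg N b))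
    rw [← smul_eq_mul, ← sum_const]
    exact sum_le_sum fun a ha => (mem_filter.1 ha).2.2
  unfold heavyCount
  rw [add_mul]
  omega

/-- Apart from `K + q * C`, the bound on the number of blocked pairs is an exact solution of the
recurrence `x ↦ (x + 1) * (1 - 2 / k)`, `k ↦ k - 1`; so it survives a move of Breaker followed by
the removal of at least `2 * (e' - K) / k` blocked pairs. -/
theorem card_restr_bound_step {e e' s K C q q' k d n : ℝ} (hn : 1 < n) (hk : 2 ≤ k)
    (hC : 0 ≤ C) (hq : 0 ≤ q) (hqq : q ≤ q')
    (he : e ≤ K + q * C + (k - 1) + d * k * (k - 1) / (n - 1)) (he' : e' ≤ e + 1)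
    (hs : 2 * e' ≤ 2 * K + k * s) :
    e' - s ≤ K + q' * C + (k - 2) + d * (k - 1) * (k - 2) / (n - 1) := by
  have hn' : (0 : ℝ) < n - 1 := by linarith
  set ρ := d / (n - 1) with hρ
  have e1 : d * k * (k - 1) / (n - 1) = ρ * k * (k - 1) := by rw [hρ]; ring
  have e2 : d * (k - 1) * (k - 2) / (n - 1) = ρ * (k - 1) * (k - 2) := by rw [hρ]; ring
  rw [e1] at he
  rw [e2]
  have hk0 : (0 : ℝ) < k := by linarith
  refine le_of_mul_le_mul_left ?_ hk0
  have h1 : (k - 2) * (e' - K) ≤ (k - 2) * (q * C + k + ρ * k * (k - 1)) :=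
    mul_le_mul_of_nonneg_left (by linarith) (by linarith)
  have h2 : q * C ≤ q' * C := mul_le_mul_of_nonneg_right hqq hC
  have h3 : k * (q * C) ≤ k * (q' * C) := mul_le_mul_of_nonneg_left h2 hk0.le
  have h4 : 0 ≤ q * C := mul_nonneg hq hC
  nlinarith

/-- A move that removes no blocked pair at all is paid for by an increase of `q`. -/
theorem card_restr_bound_step_of_heavy {e e' K q q' k d n : ℝ} (hn : 1 < n)
    (hkn : k ≤ n) (hd : 0 ≤ d) (hqq : q + 1 ≤ q')
    (he : e ≤ K + q * (2 * d + 2) + (k - 1) + d * k * (k - 1) / (n - 1)) (he' : e' ≤ e + 1) :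
    e' ≤ K + q' * (2 * d + 2) + (k - 2) + d * (k - 1) * (k - 2) / (n - 1) := by
  have hn' : (0 : ℝ) < n - 1 := by linarith
  have h1 : d * k * (k - 1) / (n - 1) = d * (k - 1) * (k - 2) / (n - 1) +
      2 * d * ((k - 1) / (n - 1)) := by ring
  have h2 : (k - 1) / (n - 1) ≤ 1 := (div_le_one hn').2 (by linarith)
  have h3 : 2 * d * ((k - 1) / (n - 1)) ≤ 2 * d * 1 := mul_le_mul_of_nonneg_left h2 (by linarith)
  have h4 : (q + 1) * (2 * d + 2) ≤ q' * (2 * d + 2) :=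
    mul_le_mul_of_nonneg_right hqq (by linarith)
  linarith

/-- The bulk of the game, down to `8 * θ` unmatched rows and columns. If `q` matched vertices are
heavy, that is, of blocked degree at least `θ`, then the unmatched ones have blocked degree at most
`θ + q`, and the number of pairs blocked among them is bounded by a quadratic in `k` that passes
from `d * n` at `k = n` to little more than `k` for small `k`. Maker matches an unmatched
heavy vertex if there is one, which happens a bounded number of times, and otherwise a
non-adjacent row and column with at least the average sum of degrees. The number
`512 * d * (d + 1)` bounds `q` by double counting, as at most `(d + 1) * n` pairs are blocked
meanwhile. -/
theorem makerWins_of_dense {d θ n k : ℕ} (hα : Fintype.card α = n) (hd : 1 ≤ d)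
    (hn₁ : 128 * d * θ ≤ n) (hn₂ : n ≤ 256 * d * θ)
    (hθ : (d + 2) * (2 * d + 3) + (512 * d * (d + 1)) * (2 * d + 2) + 512 * d * (d + 1) + 16 ≤ θ)
    (hk : 8 * θ ≤ k) {S : Finset α} {T : Finset β} {N M : Finset (α × β)}
    (hM : Matched S T M) (hS : #S = k) (hT : #T = k) (hN : #N + k ≤ (d + 1) * n)
    (hrow : ∀ u ∈ S, rowDeg N u ≤ θ + heavyCount θ N S T)
    (hcol : ∀ x ∈ T, colDeg N x ≤ θ + heavyCount θ N S T)
    (he : (#(restr N S T) : ℝ) ≤ ((d + 2) * (2 * d + 3) : ℕ) +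
      heavyCount θ N S T * (2 * d + 2) + (k - 1) + d * k * (k - 1) / (n - 1)) :
    MakerWins (k + 2) N M := by
  have hθ1 : 1 ≤ θ := by omega
  have hdθ : θ ≤ d * θ := Nat.le_mul_of_pos_left _ hd
  have hn1 : (1 : ℝ) < n := by
    have : 1 < n := by nlinarith
    exact_mod_cast this
  set Q := 512 * d * (d + 1) with hQ
  set K := (d + 2) * (2 * d + 3) with hK
  have hheavy : ∀ (N : Finset (α × β)) (S : Finset α) (T : Finset β), #N ≤ (d + 1) * n →
      heavyCount θ N S T ≤ Q := by
    intro N S T hN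
    refine Nat.le_of_mul_le_mul_right ?_ hθ1
    calc heavyCount θ N S T * θ ≤ 2 * #N := heavyCount_mul_le θ N S T
      _ ≤ 2 * ((d + 1) * (256 * d * θ)) :=
        Nat.mul_le_mul_left 2 (hN.trans (Nat.mul_le_mul_left _ hn₂))
      _ = Q * θ := by rw [hQ]; ring
  induction k, hk using Nat.le_induction generalizing S T N M with
  | base =>
    have hq := hheavy N S T (by omega)
    -- With `k = 8 * θ` and `n ≥ 128 * d * θ`, the quadratic term is at most `θ`.
    have hρ : (d : ℝ) * (8 * θ : ℕ) * ((8 * θ : ℕ) - 1) / (n - 1) ≤ θ := by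
      rw [div_le_iff₀ (by linarith)]
      have h1 : (128 * d * θ : ℝ) ≤ n := by exact_mod_cast hn₁
      have h2 : (1 : ℝ) ≤ θ := by exact_mod_cast hθ1
      have h3 : (1 : ℝ) ≤ d := by exact_mod_cast hd
      have h4 : (θ : ℝ) * (128 * d * θ) ≤ θ * n := mul_le_mul_of_nonneg_left h1 (by linarith)
      have h5 : (θ : ℝ) ≤ d * θ * θ := by nlinarith [mul_le_mul h3 h2 (by linarith) (by linarith)]
      push_cast
      nlinarith
    have he' : #(restr N S T) ≤ 8 * θ + 2 * θ := by
      have h1 : (heavyCount θ N S T : ℝ) * (2 * d + 2) ≤ Q * (2 * d + 2) :=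
        mul_le_mul_of_nonneg_right (by exact_mod_cast hq) (by positivity)
      have h2 : (K : ℝ) + Q * (2 * d + 2) ≤ θ := by
        have : K + Q * (2 * d + 2) ≤ θ := by omega
        exact_mod_cast this
      have h3 : (#(restr N S T) : ℝ) ≤ (8 * θ + 2 * θ : ℕ) := by
        push_cast at he ⊢
        push_cast at hρ
        linarith
      exact_mod_cast h3
    have hnd : 128 * θ ≤ n := by nlinarith
    have hd0 : d ≤ θ := by nlinarith
    refine makerWins_of_card_restr_le_add (A := 2 * θ) (C := d + 1) (by omega) hM hS hT he'
      (fun u hu => ?_) (fun x hx => ?_) (fun u hu => ?_) (fun x hx => ?_) (by rw [hα]; exact hN)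
      (by rw [hα]; omega)
    · have := hrow u hu
      rw [hα]; omega
    · have := hcol x hx
      rw [hα]; omega
    · have := hrow u hu
      omega
    · have := hcol x hx
      omega
  | succ k hk ih =>
    have hkn : k + 1 ≤ n := by
      rw [← hS, ← hα]; exact card_le_univ S
    refine makerWins_succ_of_matched hM fun N' hN' hc' => ?_
    have hq := hheavy N S T (by omega)
    have he' := card_restr_le_succ hN' hc' S T
    have hrow' : ∀ u ∈ S, rowDeg N' u ≤ θ + heavyCount θ N S T + 1 := fun u hu =>
      (rowDeg_le_succ hN' hc' u).trans (Nat.succ_le_succ (hrow u hu))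
    have hcol' : ∀ x ∈ T, colDeg N' x ≤ θ + heavyCount θ N S T + 1 := fun x hx =>
      (colDeg_le_succ hN' hc' x).trans (Nat.succ_le_succ (hcol x hx))
    have hrowk : ∀ u ∈ S, rowDeg (restr N' S T) u < k + 1 := by
      intro u hu
      have h1 := rowDeg_mono (restr_subset N' S T) u
      have h2 := hrow' u hu
      omega
    have hcolk : ∀ x ∈ T, colDeg (restr N' S T) x < k + 1 := by
      intro x hx
      have h1 := colDeg_mono (restr_subset N' S T) x
      have h2 := hcol' x hx
      omega
    have heR : (#(restr N' S T) : ℝ) ≤ #(restr N S T) + 1 := by exact_mod_cast he'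
    -- the two kinds of move preserve the invariant for different reasons
    have hsel : ∃ u ∈ S, ∃ x ∈ T, (u, x) ∉ restr N' S T ∧
        (∀ v ∈ S.erase u, rowDeg N' v ≤ θ + heavyCount θ N' (S.erase u) (T.erase x)) ∧
        (∀ y ∈ T.erase x, colDeg N' y ≤ θ + heavyCount θ N' (S.erase u) (T.erase x)) ∧
        (#(restr N' (S.erase u) (T.erase x)) : ℝ) ≤ K +
          heavyCount θ N' (S.erase u) (T.erase x) * (2 * d + 2) + (k - 1) +
          d * k * (k - 1) / (n - 1) := by
      have hheavyMove : ∀ u ∈ S, ∀ x ∈ T, (u, x) ∉ restr N' S T →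
          heavyCount θ N S T < heavyCount θ N' (S.erase u) (T.erase x) →
          (∀ v ∈ S.erase u, rowDeg N' v ≤ θ + heavyCount θ N' (S.erase u) (T.erase x)) ∧
          (∀ y ∈ T.erase x, colDeg N' y ≤ θ + heavyCount θ N' (S.erase u) (T.erase x)) ∧
          (#(restr N' (S.erase u) (T.erase x)) : ℝ) ≤ K +
            heavyCount θ N' (S.erase u) (T.erase x) * (2 * d + 2) + (k - 1) +
            d * k * (k - 1) / (n - 1) := by
        intro u hu x hx hux hlt
        refine ⟨fun v hv => ?_, fun y hy => ?_, ?_⟩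
        · have := hrow' v (mem_of_mem_erase hv); omega
        · have := hcol' y (mem_of_mem_erase hy); omega
        · have h1 := card_restr_erase hux
          have h2 : (#(restr N' (S.erase u) (T.erase x)) : ℝ) ≤ #(restr N' S T) := by
            have : #(restr N' (S.erase u) (T.erase x)) ≤ #(restr N' S T) := by omega
            exact_mod_cast this
          have h3 := card_restr_bound_step_of_heavy (k := (k + 1 : ℕ)) (d := d) hn1
            (by exact_mod_cast hkn) (Nat.cast_nonneg d)
            (q' := heavyCount θ N' (S.erase u) (T.erase x)) (by exact_mod_cast hlt) he
            (h2.trans heR)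
          convert h3 using 2
          · congr 1
            push_cast; ring
          · push_cast; ring
      by_cases hr : ∃ u ∈ S, θ ≤ rowDeg N' u
      · obtain ⟨u, hu, hθu⟩ := hr
        obtain ⟨x, hx, hux⟩ := exists_notMem_of_rowDeg_lt (T := T) (by rw [hT]; exact hrowk u hu)
        exact ⟨u, hu, x, hx, hux, hheavyMove u hu x hx hux
          (heavyCount_lt_of_row hN' hu hθu (erase_subset _ _))⟩
      by_cases hc : ∃ x ∈ T, θ ≤ colDeg N' x
      · obtain ⟨x, hx, hθx⟩ := hc
        obtain ⟨u, hu, hux⟩ := exists_notMem_of_colDeg_lt (S := S) (by rw [hS]; exact hcolk x hx)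
        exact ⟨u, hu, x, hx, hux, hheavyMove u hu x hx hux
          (heavyCount_lt_of_col hN' (erase_subset _ _) hx hθx)⟩
      push Not at hr hc
      have hbound : #(restr N' S T) ≤ K + (d + 2) * (k + 1) := by
        have h1 : (heavyCount θ N S T : ℝ) * (2 * d + 2) ≤ Q * (2 * d + 2) :=
          mul_le_mul_of_nonneg_right (by exact_mod_cast hq) (by positivity)
        have h2 : (Q : ℝ) * (2 * d + 2) ≤ k := by
          have : Q * (2 * d + 2) ≤ k := by omega
          exact_mod_cast this
        have h3 : (d : ℝ) * (k + 1 : ℕ) * ((k + 1 : ℕ) - 1) / (n - 1) ≤ d * (k + 1) := by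
          rw [div_le_iff₀ (by linarith)]
          have h4 : (k : ℝ) + 1 ≤ n := by exact_mod_cast hkn
          push_cast
          exact mul_le_mul_of_nonneg_left (by linarith) (by positivity)
        have h4 : (#(restr N' S T) : ℝ) ≤ (K + (d + 2) * (k + 1) : ℕ) := by
          push_cast at he h3 ⊢
          linarith
        exact_mod_cast h4
      obtain ⟨u, hu, x, hx, hux, hs⟩ := exists_notMem_of_average (restr_subset_product N' S T) hS
        hT (by omega) hrowk hcolk hbound
      refine ⟨u, hu, x, hx, hux, fun v hv => ?_, fun y hy => ?_, ?_⟩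
      · have := hr v (mem_of_mem_erase hv); omega
      · have := hc y (mem_of_mem_erase hy); omega
      · have h1 := card_restr_erase hux
        have h2 : (#(restr N' (S.erase u) (T.erase x)) : ℝ) = #(restr N' S T) -
            (rowDeg (restr N' S T) u + colDeg (restr N' S T) x : ℕ) := by
          rw [eq_sub_iff_add_eq, ← h1]; push_cast; ring
        rw [h2]
        have hk2 : (2 : ℝ) ≤ (k + 1 : ℕ) := by
          have : 2 ≤ k + 1 := by omega
          exact_mod_cast this
        have h3 := card_restr_bound_step (k := (k + 1 : ℕ)) (d := d) (C := 2 * d + 2)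
          (s := (rowDeg (restr N' S T) u + colDeg (restr N' S T) x : ℕ)) hn1
          hk2 (by positivity) (Nat.cast_nonneg (heavyCount θ N S T))
          (q' := heavyCount θ N' (S.erase u) (T.erase x))
          (by exact_mod_cast heavyCount_mono hN' (erase_subset _ _) (erase_subset _ _)) he heR
          (by exact_mod_cast hs)
        convert h3 using 2
        · congr 1
          push_cast; ring
        · push_cast; ring
    obtain ⟨u, hu, x, hx, hux, h1, h2, h3⟩ := hsel
    refine ⟨u, hu, x, hx, fun h => hux (mem_restr.2 ⟨h, hu, hx⟩), fun M' hM' => ?_⟩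
    exact ih hM' (by rw [card_erase_of_mem hu]; omega) (by rw [card_erase_of_mem hx]; omega)
      (by omega) h1 h2 h3

/-- A number of vertices in each part that suffices for Maker when every vertex has at most `d`
non-neighbours in the other part. -/
def sizeThreshold (d : ℕ) : ℕ :=
  128 * d * ((d + 2) * (2 * d + 3) + (512 * d * (d + 1)) * (2 * d + 2) + 512 * d * (d + 1) + 16)

/-- Maker wins within two moves of the optimum if `n` is large and every vertex has blocked degree
at most `d` at the start. -/
theorem makerWins_start {d n : ℕ} (hα : Fintype.card α = n) (hβ : Fintype.card β = n)
    (hd : 1 ≤ d) (hn : sizeThreshold d ≤ n)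
    {N : Finset (α × β)} (hrow : ∀ a, rowDeg N a ≤ d) (hcol : ∀ b, colDeg N b ≤ d) :
    MakerWins (n + 2) N ∅ := by
  set θ₀ := (d + 2) * (2 * d + 3) + (512 * d * (d + 1)) * (2 * d + 2) + 512 * d * (d + 1) + 16
    with hθ₀
  set θ := n / (128 * d) with hθ
  replace hn : 128 * d * θ₀ ≤ n := hn
  have hpos : 0 < 128 * d := by omega
  have h1 : θ₀ ≤ θ := by
    rw [hθ, Nat.le_div_iff_mul_le hpos, mul_comm]; exact hn
  have h2 : 128 * d * θ ≤ n := Nat.mul_div_le _ _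
  have h3 : n < 128 * d * (θ + 1) := Nat.lt_mul_div_succ _ hpos
  have h4 : n ≤ 256 * d * θ := by
    have : 1 ≤ θ := by omega
    nlinarith [Nat.mul_le_mul_left (128 * d) this]
  have hdθ : d ≤ θ := by
    have : d ≤ (d + 2) * (2 * d + 3) := by nlinarith
    omega
  have hcardN : #N ≤ d * n := by
    have : #N = ∑ a, rowDeg N a := card_eq_sum_rowDeg (T := univ) (by simp)
    rw [this, mul_comm, ← hα, ← card_univ, ← smul_eq_mul, ← sum_const]
    exact sum_le_sum fun a _ => hrow a
  have hn1 : 1 < n := by nlinarith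
  refine makerWins_of_dense hα hd h2 h4 h1 (S := univ) (T := univ) ?_ ?_ (by simp [hα])
    (by simp [hβ]) (by nlinarith) (fun u _ => ?_) (fun x _ => ?_) ?_
  · nlinarith
  · obtain ⟨f⟩ := Fintype.card_eq.1 (hα.trans hβ.symm)
    exact ⟨f, by simp, by simp⟩
  · have := hrow u; omega
  · have := hcol x; omega
  · have hN : (#(restr N univ univ) : ℝ) ≤ d * n := by
      exact_mod_cast (card_le_card (restr_subset _ _ _)).trans hcardN
    have hnR : (1 : ℝ) < n := by exact_mod_cast hn1
    have h5 : (d : ℝ) * n * (n - 1) / (n - 1) = d * n := by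
      rw [mul_div_assoc, div_self (by linarith), mul_one]
    rw [h5]
    have h6 : (0 : ℝ) ≤ ((d + 2) * (2 * d + 3) : ℕ) := Nat.cast_nonneg _
    have h7 : (0 : ℝ) ≤ heavyCount θ N univ univ * (2 * d + 2) := by positivity
    linarith

end Maker

/-! ### From pairs to edges of the graph -/

section Graph

/-- The unordered pair of a vertex of one part and a vertex of the other part. -/
def edgeOf {V : Type*} {U₁ U₂ : Set V} (p : U₁ × U₂) : Sym2 V := s((p.1 : V), (p.2 : V))

theorem edgeOf_injective {V : Type*} {U₁ U₂ : Set V} (h : Disjoint U₁ U₂) :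
    (edgeOf : U₁ × U₂ → Sym2 V).Injective := by
  rintro ⟨⟨a, ha⟩, b, hb⟩ ⟨⟨a', ha'⟩, b', hb'⟩ hab
  rcases Sym2.eq_iff.1 hab with ⟨h1, h2⟩ | ⟨h1, h2⟩
  · dsimp only at h1 h2
    subst h1 h2
    rfl
  · dsimp only at h1 h2
    subst h1 h2
    exact absurd hb' (Set.disjoint_left.1 h ha)

theorem exists_perfectMatchingSet {V : Type*} [Finite V] {G : SimpleGraph V} {U₁ U₂ : Set V}
    (h : Disjoint U₁ U₂) (hU : U₁ ∪ U₂ = Set.univ) (f : U₁ ≃ U₂)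
    (hf : ∀ a : U₁, edgeOf (a, f a) ∈ G.edgeSet) :
    ∃ W ∈ perfectMatchingSets G, ∀ e ∈ W, ∃ a, e = edgeOf (a, f a) := by
  have hadj : ∀ a : U₁, G.Adj a (f a) := hf
  let M : G.Subgraph :=
    { verts := Set.univ
      Adj := fun v w => ∃ a : U₁, (v = a ∧ w = f a) ∨ (v = f a ∧ w = a)
      adj_sub := by
        rintro v w ⟨a, ⟨rfl, rfl⟩ | ⟨rfl, rfl⟩⟩
        · exact hadj a
        · exact (hadj a).symm
      edge_vert := fun _ => Set.mem_univ _
      symm := ⟨fun v w ⟨a, ha⟩ => ⟨a, ha.symm.imp And.symm And.symm⟩⟩ }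
  have hne : ∀ (a : U₁) (b : U₂), (a : V) ≠ b := fun a b hab =>
    Set.disjoint_left.1 h a.2 (hab ▸ b.2)
  have hedge : M.edgeSet = Set.range fun a : U₁ => edgeOf (a, f a) := by
    ext e
    induction e using Sym2.ind with
    | _ v w =>
      rw [SimpleGraph.Subgraph.mem_edgeSet]
      constructor
      · rintro ⟨a, ⟨rfl, rfl⟩ | ⟨rfl, rfl⟩⟩
        · exact ⟨a, rfl⟩
        · exact ⟨a, Sym2.eq_swap⟩
      · rintro ⟨a, ha⟩
        rcases Sym2.eq_iff.1 ha with ⟨h1, h2⟩ | ⟨h1, h2⟩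
        · exact ⟨a, Or.inl ⟨h1.symm, h2.symm⟩⟩
        · exact ⟨a, Or.inr ⟨h2.symm, h1.symm⟩⟩
  refine ⟨M.edgeSet, ⟨M, ?_, ?_, rfl⟩, fun e he => ?_⟩
  · intro v _
    have hv : v ∈ U₁ ∪ U₂ := hU ▸ Set.mem_univ v
    rcases hv with hv | hv
    · refine ⟨f ⟨v, hv⟩, ⟨⟨v, hv⟩, Or.inl ⟨rfl, rfl⟩⟩, ?_⟩
      rintro w ⟨a, ⟨h1, h2⟩ | ⟨h1, -⟩⟩
      · have : a = ⟨v, hv⟩ := Subtype.ext h1.symm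
        rw [h2, this]
      · exact absurd h1 (hne ⟨v, hv⟩ _)
    · refine ⟨f.symm ⟨v, hv⟩, ⟨f.symm ⟨v, hv⟩, Or.inr ⟨by simp, rfl⟩⟩, ?_⟩
      rintro w ⟨a, ⟨h1, -⟩ | ⟨h1, h2⟩⟩
      · exact absurd h1.symm (hne a ⟨v, hv⟩)
      · have : f a = ⟨v, hv⟩ := Subtype.ext h1.symm
        rw [h2, ← this, f.symm_apply_apply]
  · have h1 : M.edgeSet.ncard = Nat.card U₁ := by
      rw [hedge, ← Set.image_univ, Set.ncard_image_of_injective, Set.ncard_univ]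
      intro a b hab
      exact congrArg Prod.fst (edgeOf_injective h hab)
    have h2 : Nat.card V = U₁.ncard + U₂.ncard := by
      rw [← Set.ncard_union_eq h, hU, Set.ncard_univ]
    have h3 : U₁.ncard = U₂.ncard := Nat.card_congr f
    have h4 : U₁.ncard = Nat.card U₁ := rfl
    omega
  · rw [hedge] at he
    obtain ⟨a, rfl⟩ := he
    exact ⟨a, rfl⟩

theorem ncard_diff_neighborSet_le {V : Type*} [Finite V] {G : SimpleGraph V} {U : Set V} {v : V}
    {n k : ℕ} (hU : U.ncard = n) (h : (n : ℤ) - k ≤ (G.neighborSet v ∩ U).ncard) :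
    (U \ G.neighborSet v).ncard ≤ k := by
  have := Set.ncard_inter_add_ncard_sdiff_eq_ncard U (G.neighborSet v)
  rw [Set.inter_comm] at this
  omega

theorem makerWinsPerfectMatchingWithin {k₁ k₂ n : ℕ}
    (hn : sizeThreshold (k₁ + k₂ + 1) ≤ n)
    {V : Type*} [Finite V] {G : SimpleGraph V} {U₁ U₂ : Set V} (hG : G.IsBipartiteWith U₁ U₂)
    (hU : U₁ ∪ U₂ = Set.univ) (h₁ : U₁.ncard = n) (h₂ : U₂.ncard = n)
    (hd₁ : ∀ u₁ ∈ U₁, (n : ℤ) - k₁ ≤ (G.neighborSet u₁ ∩ U₂).ncard)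
    (hd₂ : ∀ u₂ ∈ U₂, (n : ℤ) - k₂ ≤ (G.neighborSet u₂ ∩ U₁).ncard) :
    MakerWinsPerfectMatchingWithin G (n + 2) := by
  classical
  have := Fintype.ofFinite U₁
  have := Fintype.ofFinite U₂
  have hdis := hG.disjoint
  refine makerWinsWithin_of_makerWins (edgeOf_injective hdis)
    (fun f hf => exists_perfectMatchingSet hdis hU f hf) ?_
  refine makerWins_start (d := k₁ + k₂ + 1) ?_ ?_ (by omega) hn (fun a => ?_) (fun b => ?_)
  · rw [← Nat.card_eq_fintype_card]; exact h₁
  · rw [← Nat.card_eq_fintype_card]; exact h₂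
  · refine le_trans ?_ ((ncard_diff_neighborSet_le h₂ (hd₁ a a.2)).trans (by omega))
    rw [rowDeg, ← Set.ncard_coe_finset]
    refine Set.ncard_le_ncard_of_injOn (fun p => (p.2 : V)) (fun p hp => ?_) fun p hp q hq hpq => ?_
    · simp only [coe_filter, mem_blocked_start, Set.mem_ofPred_eq] at hp
      refine ⟨p.2.2, fun hadj => hp.1 ?_⟩
      rw [← hp.2] at hadj
      exact hadj
    · simp only [coe_filter, Set.mem_ofPred_eq] at hp hq
      exact Prod.ext (hp.2.trans hq.2.symm) (Subtype.ext hpq)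
  · refine le_trans ?_ ((ncard_diff_neighborSet_le h₁ (hd₂ b b.2)).trans (by omega))
    rw [colDeg, ← Set.ncard_coe_finset]
    refine Set.ncard_le_ncard_of_injOn (fun p => (p.1 : V)) (fun p hp => ?_) fun p hp q hq hpq => ?_
    · simp only [coe_filter, mem_blocked_start, Set.mem_ofPred_eq] at hp
      refine ⟨p.1.2, fun hadj => hp.1 ?_⟩
      rw [← hp.2] at hadj
      exact SimpleGraph.Adj.symm hadj
    · simp only [coe_filter, Set.mem_ofPred_eq] at hp hq
      exact Prod.ext (Subtype.ext hpq) (hp.2.trans hq.2.symm)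

variable {n : ℕ}

/-- The unordered pair of a left and a right vertex of the complete bipartite graph. -/
def edgeInlInr (p : Fin n × Fin n) : Sym2 (Fin n ⊕ Fin n) := s(Sum.inl p.1, Sum.inr p.2)

theorem edgeInlInr_injective : (edgeInlInr : Fin n × Fin n → _).Injective := by
  rintro ⟨a, b⟩ ⟨a', b'⟩ h
  simpa [edgeInlInr] using h

theorem exists_edgeInlInr_eq {e : Sym2 (Fin n ⊕ Fin n)}
    (he : e ∈ (completeBipartiteGraph (Fin n) (Fin n)).edgeSet) : ∃ p, edgeInlInr p = e := by
  induction e using Sym2.ind with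
  | _ v w =>
    rw [SimpleGraph.mem_edgeSet, completeBipartiteGraph_adj] at he
    rcases v with v | v <;> rcases w with w | w <;> simp at he
    · exact ⟨(v, w), rfl⟩
    · exact ⟨(w, v), Sym2.eq_swap⟩

/-- A matching with `n` edges in a spanning subgraph of `K_{n,n}` is the graph of a bijection. -/
theorem exists_equiv_of_isMatching {G : SimpleGraph (Fin n ⊕ Fin n)}
    (hG : G ≤ completeBipartiteGraph (Fin n) (Fin n)) {M : G.Subgraph} (hM : M.IsMatching)
    (hcard : M.edgeSet.ncard = n) :
    ∃ f : Fin n ≃ Fin n, ∀ a, edgeInlInr (a, f a) ∈ M.edgeSet := by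
  classical
  set P : Finset (Fin n × Fin n) := univ.filter fun p => edgeInlInr p ∈ M.edgeSet with hP
  have hmem : ∀ a b, (a, b) ∈ P ↔ M.Adj (Sum.inl a) (Sum.inr b) := by
    intro a b
    rw [hP, mem_filter, edgeInlInr, SimpleGraph.Subgraph.mem_edgeSet]
    simp
  have hPcard : #P = n := by
    have himg : M.edgeSet = edgeInlInr '' (P : Set (Fin n × Fin n)) := by
      ext e
      constructor
      · intro he
        obtain ⟨p, rfl⟩ := exists_edgeInlInr_eq
          (SimpleGraph.edgeSet_mono hG (M.edgeSet_subset he))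
        exact ⟨p, by simpa [hP] using he, rfl⟩
      · rintro ⟨p, hp, rfl⟩
        simpa [hP] using hp
    rw [himg, Set.ncard_image_of_injective _ edgeInlInr_injective, Set.ncard_coe_finset] at hcard
    exact hcard
  have hinj : Set.InjOn Prod.fst (P : Set (Fin n × Fin n)) := by
    rintro ⟨a, b⟩ hp ⟨a', b'⟩ hq (rfl : a = a')
    have h := hM.eq_of_adj_left ((hmem a b).1 hp) ((hmem a b').1 hq)
    rw [Sum.inr.inj h]
  have huniv : P.image Prod.fst = univ := by
    refine eq_univ_of_card _ ?_
    rw [card_image_of_injOn hinj, hPcard, Fintype.card_fin]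
  have hex : ∀ a, ∃ b, (a, b) ∈ P := by
    intro a
    have : a ∈ P.image Prod.fst := huniv ▸ mem_univ a
    obtain ⟨⟨a', b⟩, hp, rfl⟩ := mem_image.1 this
    exact ⟨b, hp⟩
  choose f hf using hex
  have hfinj : f.Injective := by
    intro a b hab
    have h := hM.eq_of_adj_right ((hmem _ _).1 (hf a)) (hab ▸ (hmem _ _).1 (hf b))
    exact Sum.inl.inj h
  exact ⟨Equiv.ofBijective f (Finite.injective_iff_bijective.1 hfinj),
    fun a => (hmem _ _).1 (hf a)⟩

theorem not_makerWinsPerfectMatchingWithin (hn : 1 ≤ n)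
    {M : (completeBipartiteGraph (Fin n) (Fin n)).Subgraph} (hM : M.IsPerfectMatching) :
    ¬ MakerWinsPerfectMatchingWithin
      (completeBipartiteGraph (Fin n) (Fin n) \ M.spanningCoe) (n + 1) := by
  classical
  have hadj : ∀ a, ∃ b, M.Adj (Sum.inl a) (Sum.inr b) := by
    intro a
    obtain ⟨w, hw, -⟩ := hM.1 (hM.2 (Sum.inl a))
    have h := M.adj_sub hw
    rcases w with w | w
    · simp at h
    · exact ⟨w, hw⟩
  choose m hm using hadj
  have hinj : m.Injective := fun a b hab =>
    Sum.inl.inj (hM.1.eq_of_adj_right (hm a) (hab ▸ hm b))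
  have : Nonempty (Fin n) := ⟨⟨0, hn⟩⟩
  have hstart := breakerHolds_start (Equiv.ofBijective m (Finite.injective_iff_bijective.1 hinj))
    (N := blocked edgeInlInr (completeBipartiteGraph (Fin n) (Fin n) \ M.spanningCoe).edgeSet
      (MBPosition.start _)) fun a => by
        rw [mem_blocked_start]
        exact fun h => h.2 (hm a)
  rw [Fintype.card_fin] at hstart
  refine not_makerWinsWithin_of_breakerHolds edgeInlInr_injective (fun e he => ?_) ?_ hstart
  · exact exists_edgeInlInr_eq (SimpleGraph.edgeSet_mono sdiff_le he)
  · rintro W ⟨M', hM', hcard, rfl⟩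
    refine exists_equiv_of_isMatching sdiff_le hM' ?_
    rw [hcard, Nat.card_eq_fintype_card, Fintype.card_sum, Fintype.card_fin]
    omega

end Graph

end MatchingGame

theorem mainTheorem7 :
    (∀ k₁ k₂ : ℕ, ∃ f : ℕ, ∀ n : ℕ, f ≤ n →
      ∀ (V : Type*) [Fintype V] (G : SimpleGraph V) (U₁ U₂ : Set V),
        G.IsBipartiteWith U₁ U₂ → U₁ ∪ U₂ = Set.univ →
        U₁.ncard = n → U₂.ncard = n →
        (∀ u₁ ∈ U₁, (n : ℤ) - k₁ ≤ (G.neighborSet u₁ ∩ U₂).ncard) →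
        (∀ u₂ ∈ U₂, (n : ℤ) - k₂ ≤ (G.neighborSet u₂ ∩ U₁).ncard) →
        MakerWinsPerfectMatchingWithin G (n + 2)) ∧
    (∀ n : ℕ, 1 ≤ n →
      ∀ M : (completeBipartiteGraph (Fin n) (Fin n)).Subgraph, M.IsPerfectMatching →
        ¬ MakerWinsPerfectMatchingWithin
          (completeBipartiteGraph (Fin n) (Fin n) \ M.spanningCoe) (n + 1)) := by
  refine ⟨fun k₁ k₂ => ⟨MatchingGame.sizeThreshold (k₁ + k₂ + 1),
    fun n hn V _ G U₁ U₂ hG hU h₁ h₂ hd₁ hd₂ => ?_⟩,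
    fun n hn M hM => ?_⟩
  · exact MatchingGame.makerWinsPerfectMatchingWithin hn hG hU h₁ h₂ hd₁ hd₂
  · exact MatchingGame.not_makerWinsPerfectMatchingWithin hn hM
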